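/- All manifolds are real, smooth, finite-dimensional, Hausdorff and second-countable. Let $\pi:Q\to\mathbb R$ be a smooth fibre bundle over the time axis $\mathbb R$ (with Cartesian coordinate $t$) with typical fibre $M$. Let $J^1Q=\{v\in TQ : dt(v)=1\}$ be its first order jet manifold, with the coordinates $(t,q^i,q^i_t)$ induced by local bundle coordinates $(t,q^i)$ of $Q$, where $t=\pi$. A dynamic equation on $Q\to\mathbb R$ is a holonomic connection on $J^1Q\to\mathbb R$, i.e. a smooth vector field $\xi=\partial_t+q^i_t\partial_i+\xi^i\,\partial/\partial q^i_t$ on $J^1Q$; it is written $q^i_{tt}=\xi^i(t,q^j,q^j_t)$. A reference frame is an atlas of $Q$ consisting of local bundle coordinates $(t,\overline q^i)$ whose transition functions $\overline q^i\mapsto\overline q'^i(\overline q^j)$ do not depend on $t$. A dynamic equation is a free motion equation if there is a reference frame in all of whose coordinates it reads $\overline q^i_{tt}=0$. **Proposition.** A free motion equation on $Q\to\mathbb R$ exists if and only if $M$ admits a curvature-free symmetric linear connection, i.e. a smooth linear connection on the tangent bundle $TM\to M$ whose curvature and torsion both vanish. -/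

import Mathlib

open scoped Manifold ContDiff

noncomputable section

section Configuration

variable {F : Type*} [NormedAddCommGroup F] [NormedSpace ℝ F]
  {Q : Type*} [TopologicalSpace Q] [ChartedSpace F Q]

/-- `π : Q → ℝ` is a smooth fibre bundle with typical fibre `M`: around every instant `t` there is
a local trivialization `π ⁻¹(U) ≅ U × M` over `U` which is smooth together with its inverse. -/
def IsSmoothFibreBundle {E : Type*} [NormedAddCommGroup E] [NormedSpace ℝ E]
    (M : Type*) [TopologicalSpace M] [ChartedSpace E M] (π : Q → ℝ) : Prop :=
  ∀ t : ℝ, ∃ e : Bundle.Trivialization M π, t ∈ e.baseSet ∧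
    ContMDiffOn 𝓘(ℝ, F) (𝓘(ℝ, ℝ).prod 𝓘(ℝ, E)) ∞ e e.source ∧
    ContMDiffOn (𝓘(ℝ, ℝ).prod 𝓘(ℝ, E)) 𝓘(ℝ, F) ∞ e.toOpenPartialHomeomorph.symm e.target

/-- The function `ṫ = dt(v)` on the tangent bundle `TQ`, where `t = π` is the time coordinate. -/
def timeRate (π : Q → ℝ) (v : TangentBundle 𝓘(ℝ, F) Q) : ℝ :=
  mfderiv 𝓘(ℝ, F) 𝓘(ℝ, ℝ) π v.proj v.2

/-- The first order jet manifold `J¹Q` of `π : Q → ℝ` (the velocity space), identified with its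
canonical image in `TQ`: a jet of a section `s` at `t` is the velocity vector `∂ₜ + sⁱ'(t) ∂ᵢ`, so
that `J¹Q` consists of the tangent vectors `v` with `dt(v) = 1`. -/
def jetSpace (π : Q → ℝ) : Set (TangentBundle 𝓘(ℝ, F) Q) :=
  {v | timeRate π v = 1}

/-- A (second order) dynamic equation on `π : Q → ℝ`, i.e. a holonomic connection on the jet bundle
`J¹Q → ℝ`, given by the vector field `ξ = ∂ₜ + qᵢₜ ∂ᵢ + ξⁱ ∂ᵢᵗ` on `J¹Q ⊆ TQ`.
Only the values of `field` on `J¹Q` matter. -/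
structure DynamicEquation [IsManifold 𝓘(ℝ, F) ∞ Q] (π : Q → ℝ) where
  /-- The vector field, as a map `v ↦ ξ(v) ∈ T_v(TQ)`. -/
  field : ∀ v : TangentBundle 𝓘(ℝ, F) Q, TangentSpace 𝓘(ℝ, F).tangent v
  smooth : ContMDiffOn 𝓘(ℝ, F).tangent 𝓘(ℝ, F).tangent.tangent ∞
    (fun v ↦ (⟨v, field v⟩ : TangentBundle 𝓘(ℝ, F).tangent (TangentBundle 𝓘(ℝ, F) Q)))
    (jetSpace π)
  /-- `ξ` is tangent to `J¹Q = {ṫ = 1}`. -/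
  tangent : ∀ v ∈ jetSpace π,
    mfderiv 𝓘(ℝ, F).tangent 𝓘(ℝ, ℝ) (timeRate π) v (field v) = 0
  /-- `ξ` is holonomic: it projects at `v` onto the vector `v` itself.
  In particular `dt(ξ) = dt(v) = 1`. -/
  holonomic : ∀ v ∈ jetSpace π,
    mfderiv 𝓘(ℝ, F).tangent 𝓘(ℝ, F)
      (fun w : TangentBundle 𝓘(ℝ, F) Q ↦ w.proj) v (field v) = v.2

variable {E : Type*} [NormedAddCommGroup E] [NormedSpace ℝ E]

/-- `φ` is a system of local bundle coordinates `(t, q)` on `Q`: a diffeomorphism of an open subset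
of `Q` onto an open subset of `ℝ × E` whose first component is `t = π`. -/
structure IsBundleChart (π : Q → ℝ) (φ : OpenPartialHomeomorph Q (ℝ × E)) : Prop where
  smooth : ContMDiffOn 𝓘(ℝ, F) 𝓘(ℝ, ℝ × E) ∞ φ φ.source
  smooth_symm : ContMDiffOn 𝓘(ℝ, ℝ × E) 𝓘(ℝ, F) ∞ φ.symm φ.target
  time : ∀ x ∈ φ.source, (φ x).1 = π x

/-- A reference frame on `π : Q → ℝ`: an atlas of local constant trivializations, i.e. a family of
bundle coordinates `(t, q)` whose domains cover `Q` and whose transition functions `q ↦ q'(q)` do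
not depend on `t`. -/
structure IsReferenceFrame (π : Q → ℝ) (A : Set (OpenPartialHomeomorph Q (ℝ × E))) : Prop where
  isBundleChart : ∀ φ ∈ A, IsBundleChart (F := F) π φ
  covers : ∀ x : Q, ∃ φ ∈ A, x ∈ φ.source
  time_independent : ∀ φ ∈ A, ∀ ψ ∈ A, ∀ x ∈ φ.source ∩ ψ.source, ∀ y ∈ φ.source ∩ ψ.source,
    (φ x).2 = (φ y).2 → (ψ x).2 = (ψ y).2

/-- The jet (velocity) coordinates `qₜ` on `J¹Q` induced by bundle coordinates `φ = (t, q)`: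
the `q`-component of the derivative of `φ` along the velocity `v`. -/
def jetCoord (φ : OpenPartialHomeomorph Q (ℝ × E)) (v : TangentBundle 𝓘(ℝ, F) Q) : E :=
  (mfderiv 𝓘(ℝ, F) 𝓘(ℝ, ℝ × E) φ v.proj v.2 : ℝ × E).2

/-- The right-hand side of a dynamic equation `qₜₜ = ξ(t, q, qₜ)` in bundle coordinates
`φ = (t, q)`, at the point `v` of `J¹Q`: the derivative of the jet coordinates `qₜ` along `ξ`. -/
def DynamicEquation.rhs [IsManifold 𝓘(ℝ, F) ∞ Q] {π : Q → ℝ} (ξ : DynamicEquation (F := F) π)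
    (φ : OpenPartialHomeomorph Q (ℝ × E)) (v : TangentBundle 𝓘(ℝ, F) Q) : E :=
  mfderiv 𝓘(ℝ, F).tangent 𝓘(ℝ, E) (jetCoord φ) v (ξ.field v)

/-- `ξ` is a free motion equation: there is a reference frame `(t, q)` (with `q` taking values in
the model space `E` of the typical fibre) in whose coordinates the equation reads `qₜₜ = 0`. -/
def DynamicEquation.IsFreeMotion [IsManifold 𝓘(ℝ, F) ∞ Q] {π : Q → ℝ}
    (ξ : DynamicEquation (F := F) π) (E : Type*) [NormedAddCommGroup E] [NormedSpace ℝ E] : Prop :=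
  ∃ A : Set (OpenPartialHomeomorph Q (ℝ × E)), IsReferenceFrame (F := F) π A ∧
    ∀ φ ∈ A, ∀ v ∈ jetSpace π, v.proj ∈ φ.source → ξ.rhs φ v = 0

end Configuration

section Connection

variable {E : Type*} [NormedAddCommGroup E] [NormedSpace ℝ E]
  {M : Type*} [TopologicalSpace M] [ChartedSpace E M] [IsManifold 𝓘(ℝ, E) ∞ M]

/-- The curvature `R(X, Y) Z = ∇_X ∇_Y Z - ∇_Y ∇_X Z - ∇_[X, Y] Z` of a linear connection on the
tangent bundle of `M`. (In Mathlib `∇_X Z` at `x` is written `cov Z x (X x)`.) -/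
def linearCurvature (cov : CovariantDerivative 𝓘(ℝ, E) E (TangentSpace 𝓘(ℝ, E) : M → Type _))
    (X Y Z : ∀ x : M, TangentSpace 𝓘(ℝ, E) x) (x : M) : TangentSpace 𝓘(ℝ, E) x :=
  cov (fun y ↦ cov Z y (Y y)) x (X x) - cov (fun y ↦ cov Z y (X y)) x (Y x)
    - cov Z x (VectorField.mlieBracket 𝓘(ℝ, E) X Y x)

/-- A smooth linear connection on (the tangent bundle of) `M` is symmetric and curvature-free:
its torsion vanishes and `R(X, Y) Z = 0` for all smooth vector fields. -/
structure IsFlatSymmetricConnection [FiniteDimensional ℝ E]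
    (cov : CovariantDerivative 𝓘(ℝ, E) E (TangentSpace 𝓘(ℝ, E) : M → Type _)) : Prop where
  smooth : cov.ContMDiffCovariantDerivative ∞
  symmetric : cov.torsion = 0
  curvature_free : ∀ X Y Z : ∀ x : M, TangentSpace 𝓘(ℝ, E) x,
    CMDiff ∞ (T% X) → CMDiff ∞ (T% Y) → CMDiff ∞ (T% Z) →
      ∀ x : M, linearCurvature cov X Y Z x = 0

end Connection

end

/-!
Both conditions are equivalent to the existence of an affine atlas on `M`, that is, an atlas whose
transition maps have vanishing second derivative (`IsAffineAtlas`).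

*Affine atlases and flat connections.* Taking derivatives componentwise in a chart defines a
curvature-free symmetric connection on its domain (`flatDeriv`), and a change of coordinates `τ`
alters it by `D²τ` (`IsSmoothChart.chartDeriv_flatDeriv_eq_add`). So the charts of an affine atlas
define a global connection (`IsAffineAtlas.exists_isFlatSymmetricConnection`). Conversely, given a
curvature-free symmetric connection, the charts in which it is the componentwise derivative have
affine transition maps, and they exist around every point: flatness of the Christoffel symbols `Γ`
gives a solution of `Dp = p Γ` (`exists_flat_potential`), symmetry makes the `1`-form `p` closed,
and a primitive of it is the desired chart (`exists_affine_coordinates`).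

*Affine atlases and free motions.* In coordinates `q`, the equation `q̈ = 0` is the spray
`q̇ ∂/∂q` on the tangent bundle, and a change of coordinates `τ` turns it into `q̈' = D²τ(q̇, q̇)`
(`IsSmoothChart.tangentCoordDeriv_transition`). If a dynamic equation reads `qₜₜ = 0` in two systems
of bundle coordinates, then `D²τ(w, w) = 0` for all `w` with time component `1`, which forces
`D²τ = 0`. Hence a reference frame of a free motion equation is an affine atlas of `Q`, and it
induces one on the fibre at the instant `0`. Conversely, a smooth fibre bundle over the time axis
is trivial (`IsSmoothFibreBundle.exists_isSmoothTrivialization_univ`), so that an affine atlas of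
`M` gives the affine atlas of all `(t, f)` on `Q ≅ ℝ × M`, whose charts share their spray of straight
lines; the restriction of this spray to the jet space is a free motion equation.
-/

open scoped Topology

open Set Filter

/-! ### Flat connection forms and affine coordinates in a vector space -/

/-- The linear equation `Y' = Y A` is solvable on all of `[0, 1]` when its coefficient is small: no
shrinking of the time interval is needed for the Picard iteration in the unit ball around `1`. -/
theorem exists_linear_ode_solution {𝔸 : Type*} [NormedRing 𝔸] [NormedAlgebra ℝ 𝔸]
    [CompleteSpace 𝔸] {A : ℝ → 𝔸} (hA : ContinuousOn A (Icc 0 1))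
    (hb : ∀ s ∈ Icc (0 : ℝ) 1, (‖(1 : 𝔸)‖ + 1) * ‖A s‖ ≤ 1) :
    ∃ Y : ℝ → 𝔸, Y 0 = 1 ∧ ∀ s ∈ Icc (0 : ℝ) 1,
      HasDerivWithinAt Y (Y s * A s) (Icc 0 1) s := by
  have h01 : (0 : ℝ) ∈ Icc (0 : ℝ) 1 := ⟨le_rfl, zero_le_one⟩
  have hA1 : ∀ s ∈ Icc (0 : ℝ) 1, ‖A s‖ ≤ 1 := fun s hs ↦ by
    nlinarith [hb s hs, norm_nonneg (A s), norm_nonneg (1 : 𝔸)]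
  have key : IsPicardLindelof (fun s Y ↦ Y * A s) (tmin := 0) (tmax := 1) ⟨0, h01⟩
      (1 : 𝔸) 1 0 1 1 := by
    refine ⟨fun s hs ↦ ?_, fun Y _ ↦ continuousOn_const.mul hA, fun s hs Y hY ↦ ?_, by simp⟩
    · refine LipschitzOnWith.of_dist_le_mul fun Y _ Z _ ↦ ?_
      rw [dist_eq_norm, dist_eq_norm, ← sub_mul]
      refine (norm_mul_le _ _).trans ?_
      rw [NNReal.coe_one, one_mul]
      exact mul_le_of_le_one_right (norm_nonneg _) (hA1 s hs)
    · have h1 : ‖Y‖ ≤ ‖(1 : 𝔸)‖ + 1 := by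
        have := norm_sub_norm_le Y 1
        have h2 : ‖Y - 1‖ ≤ 1 := by simpa [dist_eq_norm] using hY
        linarith
      refine (norm_mul_le _ _).trans ?_
      exact (mul_le_mul_of_nonneg_right h1 (norm_nonneg _)).trans (by simpa using hb s hs)
  simpa using key.exists_eq_forall_mem_Icc_hasDerivWithinAt₀

theorem norm_taylor_remainder_le {E G : Type*} [NormedAddCommGroup E] [NormedSpace ℝ E]
    [NormedAddCommGroup G] [NormedSpace ℝ G] {f : E → G} {s : Set E} (hs : Convex ℝ s)
    (hf : ∀ x ∈ s, DifferentiableAt ℝ f x) {L : NNReal} (hL : LipschitzOnWith L (fderiv ℝ f) s)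
    {x k : E} (hx : x ∈ s) (hk : x + k ∈ s) :
    ‖f (x + k) - f x - fderiv ℝ f x k‖ ≤ L * ‖k‖ ^ 2 := by
  have hc : Convex ℝ (s ∩ Metric.closedBall x ‖k‖) := hs.inter (convex_closedBall _ _)
  have := hc.norm_image_sub_le_of_norm_fderiv_le' (𝕜 := ℝ) (f := f) (φ := fderiv ℝ f x)
    (C := L * ‖k‖) (x := x) (y := x + k) (fun z hz ↦ hf z hz.1)
    (fun z hz ↦ (hL.norm_sub_le hz.1 hx).trans
      (mul_le_mul_of_nonneg_left (by simpa [dist_eq_norm] using hz.2) L.2))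
    ⟨hx, by simp⟩ ⟨hk, by simp⟩
  simp only [add_sub_cancel_left] at this
  linarith [this, show (L : ℝ) * ‖k‖ * ‖k‖ = L * ‖k‖ ^ 2 by ring]

/-- The algebra behind `exists_flat_potential`: for `a = Γ(sx)x`, `b = Γ(sx)h`, the first-order
terms `c = DΓ(sx)h x` and `d = DΓ(sx)x h`, and `η = ‖h‖`, everything of first order in `h` cancels
because of the flatness relation `hflat`. -/
theorem norm_flat_defect_le {𝔸 : Type*} [NormedRing 𝔸] [NormedAlgebra ℝ 𝔸] {a b c d e r : 𝔸}
    {K η s : ℝ} (hK : 0 ≤ K) (hη : 0 ≤ η) (hη1 : η ≤ 1) (hs : s ∈ Icc (0 : ℝ) 1)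
    (hflat : c - d + b * a - a * b = 0)
    (hb : ‖b‖ ≤ K * η) (hc : ‖c‖ ≤ K * η) (he : ‖e‖ ≤ K * η ^ 2) (hr : ‖r‖ ≤ 2 * K * η ^ 2) :
    ‖(1 + s • b) * (a + b + s • c + s • e + r) - a - s • (a * b) - b - s • d‖ ≤
      (3 * K + 5 * K ^ 2) * η ^ 2 := by
  obtain rfl : d = c + b * a - a * b := by
    rw [sub_add_eq_add_sub, sub_sub, sub_eq_zero] at hflat
    rw [hflat]; abel
  have h0 : (1 + s • b) * (a + b + s • c + s • e + r) - a - s • (a * b) - b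
      - s • (c + b * a - a * b)
      = s • (b * b) + s • e + (s * s) • (b * (c + e)) + (r + s • (b * r)) := by
    simp only [mul_add, add_mul, smul_add, smul_sub, one_mul, smul_mul_assoc, mul_smul_comm,
      smul_smul]
    abel
  rw [h0]
  have hs' : ‖s‖ ≤ 1 := by rw [Real.norm_of_nonneg hs.1]; exact hs.2
  have hss : ‖s * s‖ ≤ 1 := by rw [norm_mul]; nlinarith [norm_nonneg s]
  have sm : ∀ (t : ℝ) (x : 𝔸), ‖t‖ ≤ 1 → ‖t • x‖ ≤ ‖x‖ := fun t x ht ↦ by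
    rw [norm_smul]; exact mul_le_of_le_one_left (norm_nonneg _) ht
  have hη2 : η ^ 2 ≤ η := by nlinarith
  have h1 : ‖s • (b * b)‖ ≤ (K * η) * (K * η) :=
    (sm _ _ hs').trans ((norm_mul_le _ _).trans (by gcongr))
  have h2 : ‖s • e‖ ≤ K * η ^ 2 := (sm _ _ hs').trans he
  have h3 : ‖(s * s) • (b * (c + e))‖ ≤ (K * η) * (K * η + K * η) := by
    refine (sm _ _ hss).trans ((norm_mul_le _ _).trans ?_)
    have : ‖c + e‖ ≤ K * η + K * η := (norm_add_le _ _).trans (by nlinarith)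
    gcongr
  have h4 : ‖r + s • (b * r)‖ ≤ 2 * K * η ^ 2 + (K * 1) * (2 * K * η ^ 2) := by
    refine (norm_add_le _ _).trans (add_le_add hr ((sm _ _ hs').trans ((norm_mul_le _ _).trans ?_)))
    have : ‖b‖ ≤ K * 1 := hb.trans (by gcongr)
    gcongr
  calc _ ≤ _ := (norm_add_le _ _).trans (add_le_add ((norm_add_le _ _).trans
        (add_le_add ((norm_add_le _ _).trans (add_le_add h1 h2)) h3)) h4)
    _ = _ := by ring

/-- A flat connection form `Γ` with values in a Banach algebra has a local potential: a solution
`P` of `DP = P Γ` near `0` with `P 0 = 1`.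

`P x` is the value at `s = 1` of the solution of the equation along the ray `s ↦ s x`. Flatness
makes `s ↦ P(sx) (1 + s Γ(sx) h)` solve the equation along the ray through `x + h` up to an error
of order `‖h‖²`, and Grönwall's inequality turns this into the differentiability of `P`. -/
theorem exists_flat_potential {E 𝔸 : Type*} [NormedAddCommGroup E] [NormedSpace ℝ E]
    [NormedRing 𝔸] [NormedAlgebra ℝ 𝔸] [CompleteSpace 𝔸] {Γ : E → E →L[ℝ] 𝔸}
    (hΓ : ContDiffAt ℝ 2 Γ 0)
    (hflat : ∀ᶠ x in 𝓝 0, ∀ u v, fderiv ℝ Γ x u v - fderiv ℝ Γ x v u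
      + Γ x u * Γ x v - Γ x v * Γ x u = 0) :
    ∃ r > 0, ∃ P : E → 𝔸, P 0 = 1 ∧ ∀ x ∈ Metric.ball (0 : E) r,
      HasFDerivAt P ((ContinuousLinearMap.mul ℝ 𝔸 (P x)).comp (Γ x)) x := by
  have hd : ContDiffAt ℝ 1 (fderiv ℝ Γ) 0 := hΓ.fderiv_right (by norm_num)
  obtain ⟨L, t, ht, hL⟩ := hd.exists_lipschitzOnWith
  have hdiff : ∀ᶠ x in 𝓝 (0 : E), DifferentiableAt ℝ Γ x := by
    filter_upwards [hΓ.eventually (by simp)] with x hx using hx.differentiableAt (by norm_num)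
  have hK0 : ∀ᶠ x in 𝓝 (0 : E), ‖Γ x‖ < ‖Γ 0‖ + 1 :=
    hΓ.continuousAt.norm.eventually_lt_const (lt_add_one _)
  have hK1 : ∀ᶠ x in 𝓝 (0 : E), ‖fderiv ℝ Γ x‖ < ‖fderiv ℝ Γ 0‖ + 1 := by
    refine Filter.Tendsto.eventually_lt_const (lt_add_one ‖fderiv ℝ Γ 0‖) ?_
    exact (continuous_norm.tendsto (fderiv ℝ Γ 0)).comp hd.continuousAt.tendsto
  obtain ⟨ρ, hρ, H⟩ := Metric.eventually_nhds_iff_ball.1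
    ((((hdiff.and hK0).and hK1).and hflat).and ht)
  obtain ⟨K, hK1, hKΓ, hKd, hKL⟩ : ∃ K : ℝ, 1 ≤ K ∧ ‖Γ 0‖ + 1 ≤ K ∧ ‖fderiv ℝ Γ 0‖ + 1 ≤ K ∧
      (L : ℝ) ≤ K := by
    refine ⟨1 + (‖Γ 0‖ + 1) + (‖fderiv ℝ Γ 0‖ + 1) + L, ?_, ?_, ?_, ?_⟩ <;>
    nlinarith [norm_nonneg (Γ 0), norm_nonneg (fderiv ℝ Γ 0), L.coe_nonneg]
  have hKpos : 0 < K := by linarith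
  set m : ℝ := ‖(1 : 𝔸)‖ + 1
  have hm : 0 < m := by positivity
  set r : ℝ := min ρ (min 1 (1 / (m * K)))
  have hr : 0 < r := lt_min hρ (lt_min one_pos (by positivity))
  have hrρ : r ≤ ρ := min_le_left _ _
  have hr1 : r ≤ 1 := (min_le_right _ _).trans (min_le_left _ _)
  have hrm : m * (K * r) ≤ 1 := by
    have : r ≤ 1 / (m * K) := (min_le_right _ _).trans (min_le_right _ _)
    rw [le_div_iff₀ (by positivity)] at this
    linarith
  have hseg : ∀ {x : E} {s : ℝ}, x ∈ Metric.ball (0 : E) r → s ∈ Icc (0 : ℝ) 1 →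
      s • x ∈ Metric.ball (0 : E) r := fun {x s} hx hs ↦ by
    rw [mem_ball_zero_iff] at hx ⊢
    rw [norm_smul, Real.norm_of_nonneg hs.1]
    exact (mul_le_of_le_one_left (norm_nonneg _) hs.2).trans_lt hx
  have hball := Metric.ball_subset_ball hrρ (x := (0 : E))
  have bΓ : ∀ x ∈ Metric.ball (0 : E) r, ‖Γ x‖ ≤ K := fun x hx ↦
    ((H x (hball hx)).1.1.1.2.le).trans hKΓ
  have bd : ∀ x ∈ Metric.ball (0 : E) r, ‖fderiv ℝ Γ x‖ ≤ K := fun x hx ↦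
    ((H x (hball hx)).1.1.2.le).trans hKd
  have dΓ : ∀ x ∈ Metric.ball (0 : E) r, DifferentiableAt ℝ Γ x := fun x hx ↦
    (H x (hball hx)).1.1.1.1
  have hLr : LipschitzOnWith L (fderiv ℝ Γ) (Metric.ball (0 : E) r) :=
    hL.mono fun x hx ↦ (H x (hball hx)).2
  -- the coefficient of the radial equation, differentiated in the radial parameter
  have hcoef : ∀ {x h : E} {s : ℝ}, x ∈ Metric.ball (0 : E) r → s ∈ Icc (0 : ℝ) 1 →
      HasDerivAt (fun s : ℝ ↦ Γ (s • x) h) (fderiv ℝ Γ (s • x) x h) s := fun {x h s} hx hs ↦ by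
    have h1 : HasDerivAt (fun s : ℝ ↦ s • x) x s := by
      simpa using (hasDerivAt_id s).smul_const x
    have h2 := ((dΓ _ (hseg hx hs)).hasFDerivAt.comp_hasDerivAt s h1)
    simpa using h2.clm_apply (hasDerivAt_const s h)
  have hex : ∀ x : E, ∃ Y : ℝ → 𝔸, x ∈ Metric.ball (0 : E) r → Y 0 = 1 ∧
      ∀ s ∈ Icc (0 : ℝ) 1, HasDerivWithinAt Y (Y s * Γ (s • x) x) (Icc 0 1) s := fun x ↦ by
    by_cases hx : x ∈ Metric.ball (0 : E) r
    · obtain ⟨Y, hY⟩ := exists_linear_ode_solution (A := fun s ↦ Γ (s • x) x)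
        (fun s hs ↦ (hcoef hx hs).continuousAt.continuousWithinAt) (fun s hs ↦ by
          have h1 : ‖Γ (s • x) x‖ ≤ K * r := ((Γ (s • x)).le_opNorm x).trans
            (mul_le_mul (bΓ _ (hseg hx hs)) (mem_ball_zero_iff.1 hx).le (norm_nonneg _) hKpos.le)
          exact (mul_le_mul_of_nonneg_left h1 hm.le).trans hrm)
      exact ⟨Y, fun _ ↦ hY⟩
    · exact ⟨0, fun h ↦ absurd h hx⟩
  choose Y hY using hex
  refine ⟨r, hr, fun x ↦ Y x 1, ?_, fun x hx ↦ ?_⟩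
  · have h0 : (0 : E) ∈ Metric.ball (0 : E) r := Metric.mem_ball_self hr
    have := constant_of_has_deriv_right_zero (f := Y 0) (a := 0) (b := 1)
      (fun s hs ↦ ((hY 0 h0).2 s hs).continuousWithinAt)
      (fun s hs ↦ by
        have := ((hY 0 h0).2 s ⟨hs.1, hs.2.le⟩).mono_of_mem_nhdsWithin (Icc_mem_nhdsGE_of_mem hs)
        simpa using this) 1 (by simp)
    exact this.trans (hY 0 h0).1
  obtain ⟨CY, hCY⟩ := isCompact_Icc.exists_bound_of_continuousOn (f := Y x)
    (fun s hs ↦ ((hY x hx).2 s hs).continuousWithinAt)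
  have hCY0 : 0 ≤ CY := (norm_nonneg _).trans (hCY 0 (by simp))
  set C : ℝ := CY * (3 * K + 5 * K ^ 2)
  have main : ∀ h : E, x + h ∈ Metric.ball (0 : E) r → ‖h‖ ≤ 1 →
      ‖Y (x + h) 1 - Y x 1 - Y x 1 * Γ x h‖ ≤ C * Real.exp K * ‖h‖ ^ 2 := by
    intro h hxh hh
    -- `R s` compares the solution along the ray through `x + h` with its first-order prediction;
    -- `R 1` is the remainder to be estimated
    set R : ℝ → 𝔸 := fun s ↦ Y (x + h) s - Y x s * (1 + s • Γ (s • x) h)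
    set R' : ℝ → 𝔸 := fun s ↦ Y (x + h) s * Γ (s • (x + h)) (x + h) -
      (Y x s * Γ (s • x) x * (1 + s • Γ (s • x) h) +
        Y x s * (Γ (s • x) h + s • fderiv ℝ Γ (s • x) x h))
    have hR : ∀ s ∈ Icc (0 : ℝ) 1, HasDerivWithinAt R (R' s) (Icc 0 1) s := fun s hs ↦ by
      have h1 : HasDerivAt (fun s : ℝ ↦ 1 + s • Γ (s • x) h)
          (Γ (s • x) h + s • fderiv ℝ Γ (s • x) x h) s := by
        have := ((hasDerivAt_id s).smul (hcoef (h := h) hx hs)).const_add 1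
        simpa [add_comm] using this
      exact ((hY _ hxh).2 s hs).sub (((hY _ hx).2 s hs).mul h1.hasDerivWithinAt)
    have hbound : ∀ s ∈ Ico (0 : ℝ) 1, ‖R' s‖ ≤ K * ‖R s‖ + C * ‖h‖ ^ 2 := fun s hs' ↦ by
      have hs : s ∈ Icc (0 : ℝ) 1 := ⟨hs'.1, hs'.2.le⟩
      have hsx := hseg hx hs
      have hsxh := hseg hxh hs
      have nx : ‖x‖ ≤ 1 := (mem_ball_zero_iff.1 hx).le.trans hr1
      have nxh : ‖x + h‖ ≤ 1 := (mem_ball_zero_iff.1 hxh).le.trans hr1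
      set a := Γ (s • x) x
      set b := Γ (s • x) h
      set c := fderiv ℝ Γ (s • x) h x
      set d := fderiv ℝ Γ (s • x) x h
      set e := fderiv ℝ Γ (s • x) h h
      set A := Γ (s • (x + h)) (x + h)
      set q := A - (a + b + s • c + s • e)
      have hb : ‖b‖ ≤ K * ‖h‖ := (Γ (s • x)).le_of_opNorm_le (bΓ _ hsx) h
      have hdh : ‖fderiv ℝ Γ (s • x) h‖ ≤ K * ‖h‖ :=
        (fderiv ℝ Γ (s • x)).le_of_opNorm_le (bd _ hsx) h
      have hc : ‖c‖ ≤ K * ‖h‖ := (ContinuousLinearMap.le_of_opNorm_le _ hdh x).trans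
        (mul_le_of_le_one_right (by positivity) nx)
      have he : ‖e‖ ≤ K * ‖h‖ ^ 2 := (ContinuousLinearMap.le_of_opNorm_le _ hdh h).trans
        (by rw [pow_two, mul_assoc])
      have hq : ‖q‖ ≤ 2 * K * ‖h‖ ^ 2 := by
        have hq' : q = (Γ (s • x + s • h) - Γ (s • x) - fderiv ℝ Γ (s • x) (s • h)) (x + h) := by
          simp only [q, A, a, b, c, e, smul_add, map_add, map_smul,
            sub_apply, smul_apply]
          abel
        have h1 := norm_taylor_remainder_le (convex_ball (0 : E) r) dΓ hLr (x := s • x)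
          (k := s • h) hsx (by rwa [← smul_add])
        have h2 : ‖s • h‖ ≤ ‖h‖ := by
          rw [norm_smul, Real.norm_of_nonneg hs.1]
          exact mul_le_of_le_one_left (norm_nonneg _) hs.2
        have h3 : (L : ℝ) * ‖s • h‖ ^ 2 ≤ K * ‖h‖ ^ 2 := by gcongr
        rw [hq']
        refine (ContinuousLinearMap.le_of_opNorm_le _ (h1.trans h3) _).trans ?_
        have : 0 ≤ K * ‖h‖ ^ 2 := by positivity
        nlinarith
      have hA : ‖A‖ ≤ K := (ContinuousLinearMap.le_of_opNorm_le _ (bΓ _ hsxh) _).trans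
        (mul_le_of_le_one_right hKpos.le nxh)
      have hfl : c - d + b * a - a * b = 0 := (H _ (hball hsx)).1.2 h x
      have hdef := norm_flat_defect_le (r := q) hKpos.le (norm_nonneg h) hh hs hfl hb hc he hq
      have hAeq : a + b + s • c + s • e + q = A := by simp [q]
      rw [hAeq] at hdef
      have hR' : R' s = R s * A + Y x s * ((1 + s • b) * A - a - s • (a * b) - b - s • d) := by
        simp only [R', R, mul_add, add_mul, sub_mul, mul_sub, mul_one, one_mul, mul_smul_comm,
          smul_mul_assoc, mul_assoc]
        abel
      rw [hR']
      refine (norm_add_le _ _).trans (add_le_add ?_ ?_)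
      · rw [mul_comm K]
        exact (norm_mul_le _ _).trans (by gcongr)
      · refine (norm_mul_le _ _).trans ?_
        rw [mul_assoc CY]
        exact mul_le_mul (hCY s hs) hdef (norm_nonneg _) hCY0
    have hg := norm_le_gronwallBound_of_norm_deriv_right_le (f := R) (f' := R') (δ := 0) (K := K)
      (ε := C * ‖h‖ ^ 2) (a := 0) (b := 1) (fun s hs ↦ (hR s hs).continuousWithinAt)
      (fun s hs ↦ (hR s ⟨hs.1, hs.2.le⟩).mono_of_mem_nhdsWithin (Icc_mem_nhdsGE_of_mem hs))
      (by simp [R, (hY _ hx).1, (hY _ hxh).1]) hbound 1 (by simp)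
    have hR1 : R 1 = Y (x + h) 1 - Y x 1 - Y x 1 * Γ x h := by
      simp only [R, one_smul, mul_add, mul_one]; abel
    rw [hR1, gronwallBound_of_K_ne_0 hKpos.ne'] at hg
    refine hg.trans ?_
    have hC : 0 ≤ C * ‖h‖ ^ 2 := by positivity
    have h1 : C * ‖h‖ ^ 2 / K ≤ C * ‖h‖ ^ 2 := div_le_self hC hK1
    have h2 := Real.one_le_exp hKpos.le
    simp only [zero_mul, sub_zero, mul_one, zero_add]
    calc _ ≤ C * ‖h‖ ^ 2 * Real.exp K := by gcongr; linarith
      _ = _ := by ring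
  rw [hasFDerivAt_iff_isLittleO_nhds_zero]
  refine Asymptotics.IsBigO.trans_isLittleO (g := fun h : E ↦ ‖h‖ ^ 2) ?_
    (Asymptotics.isLittleO_norm_pow_id one_lt_two)
  refine Asymptotics.IsBigO.of_bound (C * Real.exp K) ?_
  have h1 : ∀ᶠ h in 𝓝 (0 : E), x + h ∈ Metric.ball (0 : E) r := by
    refine (continuous_const.add continuous_id).continuousAt.eventually_mem ?_
    exact Metric.isOpen_ball.mem_nhds (by simpa using hx)
  filter_upwards [h1, Metric.closedBall_mem_nhds (0 : E) one_pos] with h hh1 hh2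
  simpa using main h hh1 (by simpa using hh2)

/-- Bootstrapping: a solution of `DP = P Γ` is as smooth as `Γ`. -/
theorem contDiffOn_infty_of_hasFDerivAt_mul {E 𝔸 : Type*} [NormedAddCommGroup E]
    [NormedSpace ℝ E] [NormedRing 𝔸] [NormedAlgebra ℝ 𝔸] {Γ : E → E →L[ℝ] 𝔸} {P : E → 𝔸}
    {U : Set E} (hU : IsOpen U) (hΓ : ContDiffOn ℝ ∞ Γ U)
    (hP : ∀ x ∈ U, HasFDerivAt P ((ContinuousLinearMap.mul ℝ 𝔸 (P x)).comp (Γ x)) x) :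
    ContDiffOn ℝ ∞ P U := by
  refine contDiffOn_infty.2 fun n ↦ ?_
  induction n with
  | zero =>
    exact contDiffOn_zero.2 fun x hx ↦ (hP x hx).continuousAt.continuousWithinAt
  | succ n ih =>
    rw [Nat.cast_succ, contDiffOn_succ_iff_fderiv_of_isOpen hU]
    refine ⟨fun x hx ↦ (hP x hx).differentiableAt.differentiableWithinAt, by simp, ?_⟩
    have h1 : ContDiffOn ℝ n (fun x ↦ (ContinuousLinearMap.mul ℝ 𝔸 (P x)).comp (Γ x)) U :=
      ((ContinuousLinearMap.mul ℝ 𝔸).contDiff.comp_contDiffOn ih).clm_comp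
        (hΓ.of_le (mod_cast le_top))
    exact h1.congr fun x hx ↦ (hP x hx).fderiv

/-- Christoffel symbols `Γ` which are symmetric and flat admit affine coordinates around every
point: a local diffeomorphism `F` with `D²F(v, w) = DF(Γ(v, w))`.

Flatness yields a solution `p` of `Dp = p Γ`; by symmetry of `Γ` the `1`-form `p` is closed, hence
`p = DF` by the Poincaré lemma, and `F` is a local diffeomorphism where `p` is invertible. -/
theorem exists_affine_coordinates {E : Type*} [NormedAddCommGroup E] [NormedSpace ℝ E]
    [CompleteSpace E] {Γ : E → E →L[ℝ] E →L[ℝ] E} {U : Set E} (hU : IsOpen U)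
    (hΓ : ContDiffOn ℝ ∞ Γ U) (hsymm : ∀ x ∈ U, ∀ v w, Γ x v w = Γ x w v)
    (hflat : ∀ x ∈ U, ∀ u v w, fderiv ℝ Γ x u v w - fderiv ℝ Γ x v u w
      + Γ x u (Γ x v w) - Γ x v (Γ x u w) = 0) {x₀ : E} (hx₀ : x₀ ∈ U) :
    ∃ F : OpenPartialHomeomorph E E, x₀ ∈ F.source ∧ F.source ⊆ U ∧
      ContDiffOn ℝ ∞ F F.source ∧ ContDiffOn ℝ ∞ F.symm F.target ∧
      ∀ x ∈ F.source, ∀ v w, fderiv ℝ (fderiv ℝ F) x v w = fderiv ℝ F x (Γ x v w) := by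
  have htr : ContDiffAt ℝ 2 (fun y ↦ Γ (x₀ + y)) 0 := by
    have h1 : ContDiffAt ℝ 2 Γ (x₀ + 0) := by
      rw [add_zero]
      exact (hΓ.contDiffAt (hU.mem_nhds hx₀)).of_le (by norm_cast)
    exact h1.comp 0 (contDiffAt_const.add contDiffAt_id)
  have hev : ∀ᶠ y in 𝓝 (0 : E), x₀ + y ∈ U := by
    refine (continuous_const.add continuous_id).continuousAt.eventually_mem ?_
    exact hU.mem_nhds (by simpa using hx₀)
  obtain ⟨r₁, hr₁, P, hP0, hP⟩ := exists_flat_potential htr (by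
    filter_upwards [hev] with y hy u v
    ext w
    have e : fderiv ℝ (fun y ↦ Γ (x₀ + y)) y = fderiv ℝ Γ (x₀ + y) :=
      fderiv_comp_add_left (𝕜 := ℝ) (f := Γ) (x := y) x₀
    change fderiv ℝ (fun y ↦ Γ (x₀ + y)) y u v w - fderiv ℝ (fun y ↦ Γ (x₀ + y)) y v u w
      + Γ (x₀ + y) u (Γ (x₀ + y) v w) - Γ (x₀ + y) v (Γ (x₀ + y) u w) = 0
    rw [e]
    exact hflat _ hy u v w)
  obtain ⟨r₂, hr₂, hr₂U⟩ := Metric.isOpen_iff.1 hU x₀ hx₀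
  set B := Metric.ball x₀ (min r₁ r₂)
  have hBo : IsOpen B := Metric.isOpen_ball
  have hx₀B : x₀ ∈ B := Metric.mem_ball_self (lt_min hr₁ hr₂)
  have hBU : B ⊆ U := (Metric.ball_subset_ball (min_le_right _ _)).trans hr₂U
  set p : E → E →L[ℝ] E := fun y ↦ P (y - x₀)
  have hp : ∀ y ∈ B, HasFDerivAt p
      ((ContinuousLinearMap.mul ℝ (E →L[ℝ] E) (p y)).comp (Γ y)) y := fun y hy ↦ by
    have hy' : y - x₀ ∈ Metric.ball (0 : E) r₁ := by
      have := Metric.ball_subset_ball (min_le_left _ _) hy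
      simpa [dist_eq_norm] using this
    have := (hP _ hy').comp y ((hasFDerivAt_id y).sub_const x₀)
    rw [ContinuousLinearMap.comp_id, add_sub_cancel] at this
    exact this
  have hpU : ContDiffOn ℝ ∞ p B := contDiffOn_infty_of_hasFDerivAt_mul hBo (hΓ.mono hBU) hp
  obtain ⟨f, hf⟩ := (convex_ball x₀ (min r₁ r₂)).exists_forall_hasFDerivAt_of_fderiv_symmetric
    hBo (fun y hy ↦ (hp y hy).differentiableAt.differentiableWithinAt)
    (fun y hy v w ↦ by rw [(hp y hy).fderiv]; simp [hsymm y (hBU hy) v w])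
  have hfB : ContDiffOn ℝ ∞ f B := by
    rw [contDiffOn_infty_iff_fderiv_of_isOpen hBo]
    exact ⟨fun y hy ↦ (hf y hy).differentiableAt.differentiableWithinAt,
      hpU.congr fun y hy ↦ (hf y hy).fderiv⟩
  have hf0 : HasFDerivAt f ((ContinuousLinearEquiv.refl ℝ E : E ≃L[ℝ] E) : E →L[ℝ] E) x₀ := by
    have := hf x₀ hx₀B
    simp only [p, sub_self, hP0] at this
    exact this
  have hfx : ContDiffAt ℝ ∞ f x₀ := hfB.contDiffAt (hBo.mem_nhds hx₀B)
  set W : Set E := B ∩ p ⁻¹' {T | IsUnit T}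
  have hWo : IsOpen W := hpU.continuousOn.isOpen_inter_preimage hBo Units.isOpen
  have hx₀W : x₀ ∈ W := ⟨hx₀B, by simp [p, hP0]⟩
  set F₀ := hfx.toOpenPartialHomeomorph f hf0 (by simp)
  set F := F₀.restrOpen W hWo
  have hsrc : F.source = F₀.source ∩ W := F₀.restrOpen_source W hWo
  have hFW : ∀ y ∈ F.source, y ∈ W := fun y hy ↦ (hsrc ▸ hy).2
  have hFf : (F : E → E) = f := rfl
  refine ⟨F, ?_, fun y hy ↦ hBU (hFW y hy).1, ?_, fun u hu ↦ ?_, fun y hy v w ↦ ?_⟩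
  · rw [hsrc]
    exact ⟨hfx.mem_toOpenPartialHomeomorph_source hf0 (by simp), hx₀W⟩
  · exact hfB.mono fun y hy ↦ (hFW y hy).1
  · have hy := F.map_target hu
    obtain ⟨T, hT⟩ := (hFW _ hy).2
    have h1 : HasFDerivAt F ((ContinuousLinearEquiv.unitsEquiv ℝ E T : E ≃L[ℝ] E) : E →L[ℝ] E)
        (F.symm u) := by
      have h2 := hf _ (hFW _ hy).1
      rw [← hT] at h2
      exact h2
    exact (F.contDiffAt_symm hu h1
      (hfB.contDiffAt (hBo.mem_nhds (hFW _ hy).1))).contDiffWithinAt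
  · have hyB := (hFW y hy).1
    have h1 : fderiv ℝ F =ᶠ[𝓝 y] p := by
      filter_upwards [hBo.mem_nhds hyB] with z hz using (hf z hz).fderiv
    rw [h1.fderiv_eq, (hp y hyB).fderiv, h1.eq_of_nhds]
    rfl

/-! ### Smooth charts and induced coordinates on the tangent bundle -/

section SmoothChart

variable {W : Type*} [NormedAddCommGroup W] [NormedSpace ℝ W]
  {N : Type*} [TopologicalSpace N] [ChartedSpace W N]
  {V : Type*} [NormedAddCommGroup V] [NormedSpace ℝ V]

/-- `φ` is a smooth chart of `N` with values in `V`: a diffeomorphism of an open subset of `N` onto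
an open subset of `V`. The space `V` need not be the model space `W` of `N`. -/
structure IsSmoothChart (φ : OpenPartialHomeomorph N V) : Prop where
  smooth : ContMDiffOn 𝓘(ℝ, W) 𝓘(ℝ, V) ∞ φ φ.source
  smooth_symm : ContMDiffOn 𝓘(ℝ, V) 𝓘(ℝ, W) ∞ φ.symm φ.target

namespace IsSmoothChart

variable {φ ψ : OpenPartialHomeomorph N V}

theorem mdifferentiableAt (h : IsSmoothChart (W := W) φ) {x : N} (hx : x ∈ φ.source) :
    MDifferentiableAt 𝓘(ℝ, W) 𝓘(ℝ, V) φ x :=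
  (h.smooth.contMDiffAt (φ.open_source.mem_nhds hx)).mdifferentiableAt (by simp)

theorem mdifferentiableAt_symm (h : IsSmoothChart (W := W) φ) {u : V} (hu : u ∈ φ.target) :
    MDifferentiableAt 𝓘(ℝ, V) 𝓘(ℝ, W) φ.symm u :=
  (h.smooth_symm.contMDiffAt (φ.open_target.mem_nhds hu)).mdifferentiableAt (by simp)

end IsSmoothChart

/-- The differential `T_xN → V` of a chart `φ` at `x`, i.e. `mfderiv φ x` with its target read as
the vector space `V`. -/
noncomputable def chartDeriv (φ : OpenPartialHomeomorph N V) (x : N) :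
    TangentSpace 𝓘(ℝ, W) x →L[ℝ] V :=
  mfderiv 𝓘(ℝ, W) 𝓘(ℝ, V) φ x

/-- The differential at `φ x` of the inverse of the chart `φ`, as a map `V → T_xN`; for a smooth
chart `φ` with `x` in its domain it is inverse to `chartDeriv φ x`. -/
noncomputable def chartDerivInv (φ : OpenPartialHomeomorph N V) (x : N) :
    V →L[ℝ] TangentSpace 𝓘(ℝ, W) x :=
  mfderiv 𝓘(ℝ, V) 𝓘(ℝ, W) φ.symm (φ x)

namespace IsSmoothChart

variable {φ ψ : OpenPartialHomeomorph N V}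

theorem chartDerivInv_chartDeriv (h : IsSmoothChart (W := W) φ) {x : N} (hx : x ∈ φ.source)
    (v : TangentSpace 𝓘(ℝ, W) x) : chartDerivInv φ x (chartDeriv φ x v) = v := by
  have h1 := mfderiv_comp x (h.mdifferentiableAt_symm (φ.map_source hx)) (h.mdifferentiableAt hx)
  have h2 : (φ.symm ∘ φ) =ᶠ[𝓝 x] id := by
    filter_upwards [φ.open_source.mem_nhds hx] with z hz using φ.left_inv hz
  rw [h2.mfderiv_eq, mfderiv_id] at h1
  exact (congrArg (fun T ↦ T v) h1).symm

theorem chartDeriv_chartDerivInv (h : IsSmoothChart (W := W) φ) {x : N} (hx : x ∈ φ.source)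
    (w : V) : chartDeriv φ x (chartDerivInv (W := W) φ x w) = w := by
  have hu := φ.map_source hx
  have h1 := mfderiv_comp_of_eq (x := φ x) (y := x) (h.mdifferentiableAt hx)
    (h.mdifferentiableAt_symm hu) (φ.left_inv hx)
  rw [φ.left_inv hx] at h1
  have h2 : (φ ∘ φ.symm) =ᶠ[𝓝 (φ x)] id := by
    filter_upwards [φ.open_target.mem_nhds hu] with z hz using φ.right_inv hz
  rw [h2.mfderiv_eq, mfderiv_id] at h1
  exact (congrArg (fun T ↦ T w) h1).symm

theorem chartDeriv_injective (h : IsSmoothChart (W := W) φ) {x : N} (hx : x ∈ φ.source) :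
    Function.Injective (chartDeriv (W := W) φ x) :=
  Function.LeftInverse.injective (h.chartDerivInv_chartDeriv hx)

end IsSmoothChart

/-- The coordinates `(q, q̇)` on the tangent bundle induced by the coordinates `q = φ` on `N`. -/
noncomputable def tangentCoord (φ : OpenPartialHomeomorph N V) (v : TangentBundle 𝓘(ℝ, W) N) :
    V × V :=
  (φ v.proj, chartDeriv φ v.proj v.2)

/-- The tangent vector with coordinates `p = (q, q̇)`; for a smooth chart this is the inverse of
`tangentCoord φ`. -/
noncomputable def tangentCoordSymm (φ : OpenPartialHomeomorph N V) (p : V × V) :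
    TangentBundle 𝓘(ℝ, W) N :=
  ⟨φ.symm p.1, mfderiv 𝓘(ℝ, V) 𝓘(ℝ, W) φ.symm p.1 p.2⟩

theorem contMDiff_mk_tangentBundle_modelSpace :
    ContMDiff 𝓘(ℝ, V × V) 𝓘(ℝ, V).tangent ∞
      (fun p : V × V ↦ (⟨p.1, p.2⟩ : TangentBundle 𝓘(ℝ, V) V)) := by
  intro p
  rw [Bundle.contMDiffAt_totalSpace]
  refine ⟨contDiff_fst.contDiffAt.contMDiffAt, ?_⟩
  simp only [trivializationAt_model_space_apply]
  exact contDiff_snd.contDiffAt.contMDiffAt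

namespace IsSmoothChart

variable {φ ψ : OpenPartialHomeomorph N V}

theorem tangentCoordSymm_tangentCoord (h : IsSmoothChart (W := W) φ) {v : TangentBundle 𝓘(ℝ, W) N}
    (hv : v.proj ∈ φ.source) : tangentCoordSymm φ (tangentCoord φ v) = v := by
  have h1 := h.chartDerivInv_chartDeriv hv v.2
  obtain ⟨x, w⟩ := v
  refine Bundle.TotalSpace.ext (φ.left_inv hv) ?_
  exact heq_of_eq h1

theorem tangentCoord_tangentCoordSymm (h : IsSmoothChart (W := W) φ) {p : V × V}
    (hp : p.1 ∈ φ.target) : tangentCoord (W := W) φ (tangentCoordSymm φ p) = p := by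
  refine Prod.ext (φ.right_inv hp) ?_
  have := h.chartDeriv_chartDerivInv (φ.map_target hp) p.2
  simp only [chartDerivInv] at this
  rw [φ.right_inv hp] at this
  exact this

theorem contMDiffOn_tangentCoord [IsManifold 𝓘(ℝ, W) ∞ N] (h : IsSmoothChart (W := W) φ) :
    ContMDiffOn 𝓘(ℝ, W).tangent 𝓘(ℝ, V × V) ∞ (tangentCoord (W := W) φ)
      {v | v.proj ∈ φ.source} := by
  have : IsManifold 𝓘(ℝ, W) 1 N := .of_le (n := ∞) (by norm_cast)
  have h1 := h.smooth.contMDiffOn_tangentMapWithin (m := ∞) le_rfl φ.open_source.uniqueMDiffOn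
  have h2 : ContMDiffOn 𝓘(ℝ, W).tangent 𝓘(ℝ, V) ∞
      (fun v : TangentBundle 𝓘(ℝ, W) N ↦ φ v.proj) {v | v.proj ∈ φ.source} :=
    h.smooth.comp (Bundle.contMDiff_proj _).contMDiffOn fun _ hv ↦ hv
  refine h2.prodMk_space ?_
  refine ((contMDiff_snd_tangentBundle_modelSpace V 𝓘(ℝ, V)).comp_contMDiffOn h1).congr
    fun v hv ↦ ?_
  simp only [Function.comp, tangentMapWithin]
  rw [mfderivWithin_of_isOpen φ.open_source hv]
  rfl

theorem contMDiffOn_tangentCoordSymm [IsManifold 𝓘(ℝ, W) ∞ N] (h : IsSmoothChart (W := W) φ) :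
    ContMDiffOn 𝓘(ℝ, V × V) 𝓘(ℝ, W).tangent ∞ (tangentCoordSymm (W := W) φ)
      {p | p.1 ∈ φ.target} := by
  have : IsManifold 𝓘(ℝ, W) 1 N := .of_le (n := ∞) (by norm_cast)
  have h1 := h.smooth_symm.contMDiffOn_tangentMapWithin (m := ∞) le_rfl
    φ.open_target.uniqueMDiffOn
  refine (h1.comp contMDiff_mk_tangentBundle_modelSpace.contMDiffOn
    (s := {p : V × V | p.1 ∈ φ.target}) fun p hp ↦ hp).congr fun p hp ↦ ?_
  simp only [tangentCoordSymm, Function.comp, tangentMapWithin]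
  rw [mfderivWithin_of_isOpen φ.open_target hp]

end IsSmoothChart

end SmoothChart

/-! ### The flat connection of a chart -/

section Transition

variable {W : Type*} [NormedAddCommGroup W] [NormedSpace ℝ W]
  {N : Type*} [TopologicalSpace N] [ChartedSpace W N]
  {V : Type*} [NormedAddCommGroup V] [NormedSpace ℝ V]

namespace IsSmoothChart

variable {φ ψ : OpenPartialHomeomorph N V}

theorem contDiffAt_transition (hφ : IsSmoothChart (W := W) φ) (hψ : IsSmoothChart (W := W) ψ)
    {x : N} (hx : x ∈ φ.source) (hx' : x ∈ ψ.source) : ContDiffAt ℝ ∞ (ψ ∘ φ.symm) (φ x) := by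
  rw [← contMDiffAt_iff_contDiffAt]
  have h1 := hψ.smooth.contMDiffAt (ψ.open_source.mem_nhds hx')
  have h2 := hφ.smooth_symm.contMDiffAt (φ.open_target.mem_nhds (φ.map_source hx))
  exact ContMDiffAt.comp_of_eq h1 h2 (φ.left_inv hx)

theorem fderiv_transition (hφ : IsSmoothChart (W := W) φ) (hψ : IsSmoothChart (W := W) ψ)
    {x : N} (hx : x ∈ φ.source) (hx' : x ∈ ψ.source) (v : TangentSpace 𝓘(ℝ, W) x) :
    fderiv ℝ (ψ ∘ φ.symm) (φ x) (chartDeriv φ x v) = chartDeriv ψ x v := by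
  have h1 : ψ =ᶠ[𝓝 x] (ψ ∘ φ.symm) ∘ φ := by
    filter_upwards [φ.open_source.mem_nhds hx] with z hz
    simp [φ.left_inv hz]
  simp only [chartDeriv]
  rw [h1.mfderiv_eq, mfderiv_comp x
    (((hφ.contDiffAt_transition hψ hx hx').differentiableAt (by simp)).mdifferentiableAt)
    (hφ.mdifferentiableAt hx), mfderiv_eq_fderiv]
  rfl

end IsSmoothChart

/-- The coordinate expression `V → V` of the vector field `Z` in the chart `φ`; only its values on
the target of `φ` are meaningful. -/
noncomputable def coordField (φ : OpenPartialHomeomorph N V) (Z : ∀ x : N, TangentSpace 𝓘(ℝ, W) x)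
    (u : V) : V :=
  chartDeriv φ (φ.symm u) (Z (φ.symm u))

/-- The flat connection of the chart `φ`: the derivative of `Z` at `x` taken componentwise in the
coordinates `φ`. -/
noncomputable def flatDeriv (φ : OpenPartialHomeomorph N V)
    (Z : ∀ x : N, TangentSpace 𝓘(ℝ, W) x) (x : N) :
    TangentSpace 𝓘(ℝ, W) x →L[ℝ] TangentSpace 𝓘(ℝ, W) x :=
  chartDerivInv φ x ∘L fderiv ℝ (coordField φ Z) (φ x) ∘L chartDeriv φ x

theorem coordField_apply (φ : OpenPartialHomeomorph N V) (Z : ∀ x : N, TangentSpace 𝓘(ℝ, W) x)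
    {x : N} (hx : x ∈ φ.source) : coordField φ Z (φ x) = chartDeriv φ x (Z x) := by
  simp only [coordField]
  rw [φ.left_inv hx]

namespace IsSmoothChart

variable {φ ψ : OpenPartialHomeomorph N V} {Z Y : ∀ x : N, TangentSpace 𝓘(ℝ, W) x} {x : N}

theorem chartDeriv_flatDeriv (hφ : IsSmoothChart (W := W) φ) (hx : x ∈ φ.source)
    (v : TangentSpace 𝓘(ℝ, W) x) :
    chartDeriv φ x (flatDeriv φ Z x v) =
      fderiv ℝ (coordField φ Z) (φ x) (chartDeriv φ x v) :=
  hφ.chartDeriv_chartDerivInv hx _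

theorem coordField_flatDeriv (hφ : IsSmoothChart (W := W) φ) {u : V} (hu : u ∈ φ.target) :
    coordField φ (fun y ↦ flatDeriv φ Z y (Y y)) u =
      fderiv ℝ (coordField φ Z) u (coordField φ Y u) := by
  simp only [coordField]
  rw [hφ.chartDeriv_flatDeriv (φ.map_target hu), φ.right_inv hu]

variable [IsManifold 𝓘(ℝ, W) ∞ N]

theorem contDiffAt_coordField (hφ : IsSmoothChart (W := W) φ) (hx : x ∈ φ.source)
    (hZ : CMDiffAt ∞ (T% Z) x) : ContDiffAt ℝ ∞ (coordField φ Z) (φ x) := by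
  rw [← contMDiffAt_iff_contDiffAt]
  have h1 := hφ.contMDiffOn_tangentCoord.contMDiffAt (x := (T% Z) x)
    ((φ.open_source.preimage (FiberBundle.continuous_proj _ _)).mem_nhds hx)
  have h2 := hφ.smooth_symm.contMDiffAt (φ.open_target.mem_nhds (φ.map_source hx))
  have h3 : ContMDiffAt 𝓘(ℝ, V) 𝓘(ℝ, V × V) ∞ (fun u ↦ tangentCoord φ ((T% Z) (φ.symm u))) (φ x) :=
    ContMDiffAt.comp_of_eq h1 (ContMDiffAt.comp_of_eq hZ h2 (φ.left_inv hx))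
      (by simp only; rw [φ.left_inv hx])
  exact contDiff_snd.contMDiff.contMDiffAt.comp _ h3

theorem differentiableAt_coordField (hφ : IsSmoothChart (W := W) φ) (hx : x ∈ φ.source)
    (hZ : MDiffAt (T% Z) x) : DifferentiableAt ℝ (coordField φ Z) (φ x) := by
  rw [← mdifferentiableAt_iff_differentiableAt]
  have h1 := (hφ.contMDiffOn_tangentCoord.contMDiffAt (x := (T% Z) x)
    ((φ.open_source.preimage (FiberBundle.continuous_proj _ _)).mem_nhds hx)).mdifferentiableAt
      (by simp)
  have h2 := hφ.mdifferentiableAt_symm (φ.map_source hx)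
  have h3 : MDifferentiableAt 𝓘(ℝ, V) 𝓘(ℝ, V × V) (fun u ↦ tangentCoord φ ((T% Z) (φ.symm u)))
      (φ x) :=
    MDifferentiableAt.comp_of_eq (x := φ x) (y := (T% Z) x) h1
      (MDifferentiableAt.comp_of_eq (x := φ x) (y := x) hZ h2 (φ.left_inv hx))
      (by simp only; rw [φ.left_inv hx])
  exact differentiable_snd.mdifferentiable.mdifferentiableAt.comp _ h3

/-- Under a change of coordinates the componentwise derivative changes by the second derivative of
the transition map. -/
theorem chartDeriv_flatDeriv_eq_add (hφ : IsSmoothChart (W := W) φ)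
    (hψ : IsSmoothChart (W := W) ψ) (hx : x ∈ φ.source) (hx' : x ∈ ψ.source)
    (hZ : MDiffAt (T% Z) x) (v : TangentSpace 𝓘(ℝ, W) x) :
    chartDeriv ψ x (flatDeriv ψ Z x v) = chartDeriv ψ x (flatDeriv φ Z x v) +
      fderiv ℝ (fderiv ℝ (ψ ∘ φ.symm)) (φ x) (chartDeriv φ x v) (chartDeriv φ x (Z x)) := by
  set τ : V → V := ψ ∘ φ.symm with hτ
  have hev : coordField ψ Z ∘ τ =ᶠ[𝓝 (φ x)] fun u ↦ fderiv ℝ τ u (coordField φ Z u) := by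
    have h1 : ∀ᶠ u in 𝓝 (φ x), φ.symm u ∈ ψ.source :=
      (φ.continuousAt_symm (φ.map_source hx)).eventually_mem
        (ψ.open_source.mem_nhds (by rwa [φ.left_inv hx]))
    filter_upwards [h1, φ.open_target.mem_nhds (φ.map_source hx)] with u hu hu'
    have h2 := hφ.fderiv_transition hψ (φ.map_target hu') hu (Z (φ.symm u))
    rw [φ.right_inv hu'] at h2
    simp only [hτ, Function.comp]
    rw [coordField_apply ψ Z hu]
    exact h2.symm
  have hτd : ContDiffAt ℝ ∞ τ (φ x) := hφ.contDiffAt_transition hψ hx hx'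
  have hτx : τ (φ x) = ψ x := by simp [hτ, φ.left_inv hx]
  have hd1 : HasFDerivAt (coordField ψ Z ∘ τ)
      ((fderiv ℝ (coordField ψ Z) (ψ x)).comp (fderiv ℝ τ (φ x))) (φ x) := by
    rw [← hτx]
    refine HasFDerivAt.comp (φ x) (DifferentiableAt.hasFDerivAt ?_)
      (hτd.differentiableAt (by simp)).hasFDerivAt
    rw [hτx]
    exact hψ.differentiableAt_coordField hx' hZ
  have hd2 := (((hτd.fderiv_right (m := ∞) le_rfl).differentiableAt
    (by simp)).hasFDerivAt).clm_apply (hφ.differentiableAt_coordField hx hZ).hasFDerivAt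
  have h := congrArg (fun T ↦ T (chartDeriv φ x v))
    ((hd1.congr_of_eventuallyEq hev.symm).unique hd2)
  simp only [ContinuousLinearMap.comp_apply, add_apply, ContinuousLinearMap.flip_apply] at h
  rw [hτ, hφ.fderiv_transition hψ hx hx', coordField_apply φ Z hx] at h
  rw [hψ.chartDeriv_flatDeriv hx', h, ← hφ.chartDeriv_flatDeriv hx,
    hφ.fderiv_transition hψ hx hx']

end IsSmoothChart

end Transition

section FlatDerivative

variable {W : Type*} [NormedAddCommGroup W] [NormedSpace ℝ W]
  {N : Type*} [TopologicalSpace N] [ChartedSpace W N] [IsManifold 𝓘(ℝ, W) ∞ N]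
  {V : Type*} [NormedAddCommGroup V] [NormedSpace ℝ V]

namespace IsSmoothChart

variable {φ ψ : OpenPartialHomeomorph N V} {X Y Z : ∀ x : N, TangentSpace 𝓘(ℝ, W) x} {x : N}

theorem isCovariantDerivativeOn_flatDeriv (hφ : IsSmoothChart (W := W) φ) :
    IsCovariantDerivativeOn W (flatDeriv (W := W) φ) φ.source where
  add {σ σ' x} hσ hσ' hx := by
    have h1 : coordField φ (σ + σ') = coordField φ σ + coordField φ σ' := by
      funext u; simp [coordField]
    ext v
    simp only [flatDeriv, h1]
    rw [fderiv_add (hφ.differentiableAt_coordField hx hσ) (hφ.differentiableAt_coordField hx hσ')]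
    simp
  leibniz {σ g x} hσ hg hx := by
    have h1 : coordField φ (g • σ) = (g ∘ φ.symm) • coordField φ σ := by
      funext u; simp [coordField]
    have h2 : MDifferentiableAt 𝓘(ℝ, V) 𝓘(ℝ, ℝ) (g ∘ φ.symm) (φ x) :=
      MDifferentiableAt.comp_of_eq (x := φ x) (y := x) hg
        (hφ.mdifferentiableAt_symm (φ.map_source hx)) (φ.left_inv hx)
    have h3 : ∀ v : TangentSpace 𝓘(ℝ, W) x,
        fderiv ℝ (g ∘ φ.symm) (φ x) (chartDeriv φ x v) = (d% g x) v := fun v ↦ by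
      have h4 : g =ᶠ[𝓝 x] (g ∘ φ.symm) ∘ φ := by
        filter_upwards [φ.open_source.mem_nhds hx] with z hz
        simp [φ.left_inv hz]
      simp only [mvfderiv]
      rw [h4.mfderiv_eq, mfderiv_comp x h2 (hφ.mdifferentiableAt hx), mfderiv_eq_fderiv]
      rfl
    have h5 := (h2.differentiableAt.hasFDerivAt.smul
      (hφ.differentiableAt_coordField hx hσ).hasFDerivAt).fderiv
    ext v
    simp only [flatDeriv, h1]
    rw [h5]
    simp [h3, coordField_apply φ σ hx, φ.left_inv hx, hφ.chartDerivInv_chartDeriv hx]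

/-- The Lie bracket in coordinates. -/
theorem chartDeriv_mlieBracket [CompleteSpace W] [CompleteSpace V] (hφ : IsSmoothChart (W := W) φ)
    (hx : x ∈ φ.source) (hX : MDiffAt (T% X) x) (hY : MDiffAt (T% Y) x) :
    chartDeriv φ x (VectorField.mlieBracket 𝓘(ℝ, W) X Y x) =
      fderiv ℝ (coordField φ Y) (φ x) (chartDeriv φ x (X x)) -
        fderiv ℝ (coordField φ X) (φ x) (chartDeriv φ x (Y x)) := by
  have hpull : ∀ Z : ∀ x : N, TangentSpace 𝓘(ℝ, W) x, ∀ u ∈ φ.target,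
      VectorField.mpullback 𝓘(ℝ, V) 𝓘(ℝ, W) φ.symm Z u = coordField φ Z u := fun Z u hu ↦ by
    have hs := φ.map_target hu
    let e : V ≃L[ℝ] TangentSpace 𝓘(ℝ, W) (φ.symm u) :=
      .equivOfInverse (chartDerivInv φ (φ.symm u)) (chartDeriv φ (φ.symm u))
        (hφ.chartDeriv_chartDerivInv hs) (hφ.chartDerivInv_chartDeriv hs)
    have he : (mfderiv 𝓘(ℝ, V) 𝓘(ℝ, W) φ.symm u) =
        (e : V →L[ℝ] TangentSpace 𝓘(ℝ, W) (φ.symm u)) := by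
      ext w
      change _ = chartDerivInv φ (φ.symm u) w
      simp only [chartDerivInv]
      rw [φ.right_inv hu]
      rfl
    rw [VectorField.mpullback_apply, he]
    exact congrArg (fun T : TangentSpace 𝓘(ℝ, W) (φ.symm u) →L[ℝ] V ↦ T (Z (φ.symm u)))
      (ContinuousLinearMap.inverse_equiv e)
  have hu := φ.map_source hx
  have : IsManifold 𝓘(ℝ, W) (minSmoothness ℝ 3) N := by
    rw [minSmoothness_of_isRCLikeNormedField]
    exact .of_le (n := ∞) (by norm_cast)
  have h1 := VectorField.mpullback_mlieBracket (I := 𝓘(ℝ, V)) (I' := 𝓘(ℝ, W)) (n := ∞)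
    (f := φ.symm) (x₀ := φ x) (V := X) (W := Y)
    (by rwa [φ.left_inv hx]) (by rwa [φ.left_inv hx])
    (hφ.smooth_symm.contMDiffAt (φ.open_target.mem_nhds hu))
    (by rw [minSmoothness_of_isRCLikeNormedField]; norm_cast)
  rw [hpull _ _ hu, coordField_apply φ _ hx] at h1
  have hev : ∀ Z : ∀ x : N, TangentSpace 𝓘(ℝ, W) x,
      VectorField.mpullback 𝓘(ℝ, V) 𝓘(ℝ, W) φ.symm Z =ᶠ[𝓝 (φ x)] coordField φ Z := fun Z ↦ by
    filter_upwards [φ.open_target.mem_nhds hu] with u hu using hpull Z u hu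
  have hlie : ∀ A B : ∀ u : V, TangentSpace 𝓘(ℝ, V) u,
      VectorField.mlieBracket 𝓘(ℝ, V) A B (φ x) = VectorField.lieBracket ℝ A B (φ x) := fun A B ↦ by
    rw [← VectorField.mlieBracketWithin_univ, VectorField.mlieBracketWithin_eq_lieBracketWithin]
    exact congrFun (VectorField.lieBracketWithin_univ (𝕜 := ℝ) (E := V) (V := A) (W := B)) _
  rw [h1, (hev X).mlieBracket_vectorField_eq (hev Y)]
  refine (hlie _ _).trans ?_
  simp only [VectorField.lieBracket]
  rw [coordField_apply φ X hx, coordField_apply φ Y hx]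

/-- The flat connection of a chart has no torsion. -/
theorem flatDeriv_sub_flatDeriv [CompleteSpace W] [CompleteSpace V]
    (hφ : IsSmoothChart (W := W) φ)
    (hx : x ∈ φ.source) (hX : MDiffAt (T% X) x) (hY : MDiffAt (T% Y) x) :
    flatDeriv φ Y x (X x) - flatDeriv φ X x (Y x) = VectorField.mlieBracket 𝓘(ℝ, W) X Y x := by
  apply hφ.chartDeriv_injective hx
  rw [map_sub, hφ.chartDeriv_flatDeriv hx, hφ.chartDeriv_flatDeriv hx,
    hφ.chartDeriv_mlieBracket hx hX hY]

theorem contMDiffAt_of_coordField (hφ : IsSmoothChart (W := W) φ) (hx : x ∈ φ.source)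
    (h : ContDiffAt ℝ ∞ (coordField φ Z) (φ x)) : CMDiffAt ∞ (T% Z) x := by
  have h1 := hφ.smooth.contMDiffAt (φ.open_source.mem_nhds hx)
  have h2 : ContMDiffAt 𝓘(ℝ, W) 𝓘(ℝ, V × V) ∞ (fun y ↦ (φ y, coordField φ Z (φ y))) x :=
    h1.prodMk_space (h.contMDiffAt.comp x h1)
  have h3 := (hφ.contMDiffOn_tangentCoordSymm.contMDiffAt (x := (φ x, coordField φ Z (φ x)))
    ((φ.open_target.preimage continuous_fst).mem_nhds (φ.map_source hx))).comp x h2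
  refine h3.congr_of_eventuallyEq ?_
  filter_upwards [φ.open_source.mem_nhds hx] with y hy
  have := hφ.tangentCoordSymm_tangentCoord (v := (T% Z) y) hy
  simp only [Function.comp]
  rw [coordField_apply φ Z hy]
  exact this.symm

theorem contMDiffAt_flatDeriv (hφ : IsSmoothChart (W := W) φ) (hx : x ∈ φ.source)
    (hZ : CMDiffAt ∞ (T% Z) x) (hY : CMDiffAt ∞ (T% Y) x) :
    CMDiffAt ∞ (T% (fun y ↦ flatDeriv φ Z y (Y y))) x := by
  refine hφ.contMDiffAt_of_coordField hx ?_
  have h := ((hφ.contDiffAt_coordField hx hZ).fderiv_right (m := ∞) le_rfl).clm_apply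
    (hφ.contDiffAt_coordField hx hY)
  refine h.congr_of_eventuallyEq ?_
  filter_upwards [φ.open_target.mem_nhds (φ.map_source hx)] with u hu
    using hφ.coordField_flatDeriv hu

/-- The flat connection of a chart has no curvature. -/
theorem flatDeriv_curvature [CompleteSpace W] [CompleteSpace V] (hφ : IsSmoothChart (W := W) φ)
    (hx : x ∈ φ.source) (hX : CMDiffAt ∞ (T% X) x) (hY : CMDiffAt ∞ (T% Y) x)
    (hZ : CMDiffAt ∞ (T% Z) x) :
    flatDeriv φ (fun y ↦ flatDeriv φ Z y (Y y)) x (X x) -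
      flatDeriv φ (fun y ↦ flatDeriv φ Z y (X y)) x (Y x) -
        flatDeriv φ Z x (VectorField.mlieBracket 𝓘(ℝ, W) X Y x) = 0 := by
  apply hφ.chartDeriv_injective hx
  have hu := φ.map_source hx
  have hZ' := hφ.contDiffAt_coordField hx hZ
  have key : ∀ Y : ∀ x : N, TangentSpace 𝓘(ℝ, W) x, CMDiffAt ∞ (T% Y) x → ∀ w : V,
      fderiv ℝ (coordField φ (fun y ↦ flatDeriv φ Z y (Y y))) (φ x) w =
        fderiv ℝ (fderiv ℝ (coordField φ Z)) (φ x) w (chartDeriv φ x (Y x)) +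
        fderiv ℝ (coordField φ Z) (φ x) (fderiv ℝ (coordField φ Y) (φ x) w) := fun Y hY w ↦ by
    have hev : coordField φ (fun y ↦ flatDeriv φ Z y (Y y)) =ᶠ[𝓝 (φ x)]
        fun u ↦ fderiv ℝ (coordField φ Z) u (coordField φ Y u) := by
      filter_upwards [φ.open_target.mem_nhds hu] with u hu using hφ.coordField_flatDeriv hu
    have h := ((hZ'.fderiv_right (m := ∞) le_rfl).differentiableAt (by simp)).hasFDerivAt.clm_apply
      ((hφ.contDiffAt_coordField hx hY).differentiableAt (by simp)).hasFDerivAt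
    rw [hev.fderiv_eq, h.fderiv]
    simp [coordField_apply φ Y hx, add_comm]
  have hsymm : IsSymmSndFDerivAt ℝ (coordField φ Z) (φ x) :=
    hZ'.isSymmSndFDerivAt (by rw [minSmoothness_of_isRCLikeNormedField]; norm_cast)
  rw [map_sub, map_sub, hφ.chartDeriv_flatDeriv hx, hφ.chartDeriv_flatDeriv hx,
    hφ.chartDeriv_flatDeriv hx, hφ.chartDeriv_mlieBracket hx (hX.mdifferentiableAt (by simp))
      (hY.mdifferentiableAt (by simp)), key Y hY, key X hX, map_sub, map_zero,
    hsymm.eq (chartDeriv φ x (X x))]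
  abel

end IsSmoothChart

/-- A field of endomorphisms of the tangent spaces is smooth if it maps smooth vector fields to
smooth vector fields; finite-dimensionality reduces this to the values on a basis. -/
theorem contMDiffAt_hom_of_apply [FiniteDimensional ℝ W]
    {A : ∀ x : N, TangentSpace 𝓘(ℝ, W) x →L[ℝ] TangentSpace 𝓘(ℝ, W) x} {x : N}
    (h : ∀ Y : ∀ x : N, TangentSpace 𝓘(ℝ, W) x, CMDiffAt ∞ (T% Y) x →
      CMDiffAt ∞ (T% (fun y ↦ A y (Y y))) x) :
    ContMDiffAt 𝓘(ℝ, W) (𝓘(ℝ, W).prod 𝓘(ℝ, W →L[ℝ] W)) ∞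
      (fun y ↦ (⟨y, A y⟩ : Bundle.TotalSpace (W →L[ℝ] W)
        fun y : N ↦ TangentSpace 𝓘(ℝ, W) y →L[ℝ] TangentSpace 𝓘(ℝ, W) y)) x := by
  rw [contMDiffAt_hom_bundle]
  refine ⟨contMDiffAt_id, ?_⟩
  set t := trivializationAt W (TangentSpace 𝓘(ℝ, W) : N → Type _) x
  have hxt : x ∈ t.baseSet := FiberBundle.mem_baseSet_trivializationAt' x
  set f : N → W →L[ℝ] W := fun y ↦ ContinuousLinearMap.inCoordinates W
    (TangentSpace 𝓘(ℝ, W) : N → Type _) W (TangentSpace 𝓘(ℝ, W) : N → Type _) x y x y (A y)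
  have hw : ∀ w : W, ContMDiffAt 𝓘(ℝ, W) 𝓘(ℝ, W) ∞ (fun y ↦ f y w) x := fun w ↦ by
    have hY : CMDiffAt ∞ (T% (fun y ↦ t.symmL ℝ y w)) x := by
      rw [t.contMDiffAt_section_iff hxt]
      refine (contMDiffAt_const (c := w)).congr_of_eventuallyEq ?_
      filter_upwards [t.open_baseSet.mem_nhds hxt] with y hy
      simp [hy]
    have h1 := h _ hY
    rw [t.contMDiffAt_section_iff hxt] at h1
    refine h1.congr_of_eventuallyEq ?_
    filter_upwards [t.open_baseSet.mem_nhds hxt] with y hy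
    exact congrFun (t.coe_linearMapAt_of_mem (R := ℝ) hy) _
  let b := Module.finBasis ℝ W
  have hf : f = fun y ↦ ∑ i, ContinuousLinearMap.smulRightL ℝ W W
      (LinearMap.toContinuousLinearMap (b.coord i)) (f y (b i)) := by
    funext y
    ext w
    have h1 := congrArg (f y) (b.sum_repr w)
    rw [map_sum] at h1
    rw [← h1]
    simp
  change ContMDiffAt 𝓘(ℝ, W) 𝓘(ℝ, W →L[ℝ] W) ∞ f x
  rw [hf]
  refine ContMDiffAt.sum fun i _ ↦ ?_
  exact (ContinuousLinearMap.contDiff _).contMDiff.contMDiffAt.comp x (hw (b i))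

end FlatDerivative

/-! ### From affine atlases to flat connections -/

section AffineAtlas

/-- An affine atlas on a manifold `N` modelled on `W`: smooth charts with values in `V` whose
domains cover `N` and whose transition maps are locally affine, i.e. have vanishing second
derivative. The chart values are allowed in a space `V` other than `W`, as is the case for bundle
coordinates. -/
structure IsAffineAtlas {W : Type*} [NormedAddCommGroup W] [NormedSpace ℝ W]
    {N : Type*} [TopologicalSpace N] [ChartedSpace W N]
    {V : Type*} [NormedAddCommGroup V] [NormedSpace ℝ V]
    (B : Set (OpenPartialHomeomorph N V)) : Prop where
  isSmoothChart : ∀ φ ∈ B, IsSmoothChart (W := W) φ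
  covers : ∀ x : N, ∃ φ ∈ B, x ∈ φ.source
  affine : ∀ φ ∈ B, ∀ ψ ∈ B, ∀ x ∈ φ.source ∩ ψ.source,
    fderiv ℝ (fderiv ℝ (ψ ∘ φ.symm)) (φ x) = 0

variable {E : Type*} [NormedAddCommGroup E] [NormedSpace ℝ E]
  {M : Type*} [TopologicalSpace M] [ChartedSpace E M]

variable [IsManifold 𝓘(ℝ, E) ∞ M] [FiniteDimensional ℝ E]

/-- The flat connections of the charts of an affine atlas agree on overlaps and define a
curvature-free symmetric connection. -/
theorem IsAffineAtlas.exists_isFlatSymmetricConnection {B : Set (OpenPartialHomeomorph M E)}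
    (hB : IsAffineAtlas (W := E) B) :
    ∃ cov : CovariantDerivative 𝓘(ℝ, E) E (TangentSpace 𝓘(ℝ, E) : M → Type _),
      IsFlatSymmetricConnection cov := by
  choose c hcB hc using hB.covers
  have hs : ∀ φ ∈ B, IsSmoothChart (W := E) φ := hB.isSmoothChart
  let cov : CovariantDerivative 𝓘(ℝ, E) E (TangentSpace 𝓘(ℝ, E) : M → Type _) :=
    { toFun := fun Z x ↦ flatDeriv (c x) Z x
      isCovariantDerivativeOnUniv :=
        { add := fun {σ σ' x} hσ hσ' _ ↦
            (hs _ (hcB x)).isCovariantDerivativeOn_flatDeriv.add hσ hσ' (hc x)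
          leibniz := fun {σ g x} hσ hg _ ↦
            (hs _ (hcB x)).isCovariantDerivativeOn_flatDeriv.leibniz hσ hg (hc x) } }
  have hcov : ∀ φ ∈ B, ∀ x ∈ φ.source, ∀ Z : ∀ x : M, TangentSpace 𝓘(ℝ, E) x,
      MDiffAt (T% Z) x → cov Z x = flatDeriv φ Z x := fun φ hφ x hx Z hZ ↦ by
    ext v
    apply (hs _ hφ).chartDeriv_injective hx
    have h := (hs _ (hcB x)).chartDeriv_flatDeriv_eq_add (hs _ hφ) (hc x) hx hZ v
    rw [hB.affine _ (hcB x) _ hφ x ⟨hc x, hx⟩] at h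
    simpa using h.symm
  have hcurv : ∀ φ ∈ B, ∀ x ∈ φ.source, ∀ Y Z : ∀ x : M, TangentSpace 𝓘(ℝ, E) x,
      CMDiff ∞ (T% Y) → CMDiff ∞ (T% Z) →
        cov (fun y ↦ cov Z y (Y y)) x = flatDeriv φ (fun y ↦ flatDeriv φ Z y (Y y)) x :=
    fun φ hφ x hx Y Z hY hZ ↦ by
    have hev : ∀ᶠ y in 𝓝 x, cov Z y (Y y) = flatDeriv φ Z y (Y y) := by
      filter_upwards [φ.open_source.mem_nhds hx] with y hy
      rw [hcov φ hφ y hy Z ((hZ y).mdifferentiableAt (by simp))]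
    have h1 : MDiffAt (T% (fun y ↦ flatDeriv φ Z y (Y y))) x :=
      ((hs _ hφ).contMDiffAt_flatDeriv hx (hZ x) (hY x)).mdifferentiableAt (by simp)
    have h2 : MDiffAt (T% (fun y ↦ cov Z y (Y y))) x := by
      refine h1.congr_of_eventuallyEq ?_
      filter_upwards [hev] with y hy
      simp only [hy]
    rw [cov.isCovariantDerivativeOn.congr_of_eventuallyEq h2 h1 univ_mem hev, hcov φ hφ x hx _ h1]
  refine ⟨cov, ⟨⟨fun {σ} hσ x _ ↦ ?_⟩⟩, ?_, fun X Y Z hX hY hZ x ↦ ?_⟩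
  · have hσ' : CMDiff ∞ (T% σ) := contMDiffOn_univ.1 hσ
    refine ContMDiffAt.contMDiffWithinAt (ContMDiffAt.congr_of_eventuallyEq
      (contMDiffAt_hom_of_apply fun Y hY ↦
        (hs _ (hcB x)).contMDiffAt_flatDeriv (hc x) (hσ' x) hY) ?_)
    filter_upwards [(c x).open_source.mem_nhds (hc x)] with y hy
    rw [hcov _ (hcB x) y hy σ ((hσ' y).mdifferentiableAt (by simp))]
  · rw [CovariantDerivative.torsion_eq_zero_iff]
    intro X Y x hX hY
    exact (hs _ (hcB x)).flatDeriv_sub_flatDeriv (hc x) hX hY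
  · rw [linearCurvature, hcurv _ (hcB x) x (hc x) Y Z hY hZ, hcurv _ (hcB x) x (hc x) X Z hX hZ]
    exact (hs _ (hcB x)).flatDeriv_curvature (hc x) (hX x) (hY x) (hZ x)

end AffineAtlas

/-! ### From flat connections to affine atlases -/

section ConnectionForm

variable {W : Type*} [NormedAddCommGroup W] [NormedSpace ℝ W] [FiniteDimensional ℝ W]
  {N : Type*} [TopologicalSpace N] [ChartedSpace W N] [IsManifold 𝓘(ℝ, W) ∞ N]

/-- The Christoffel symbols `G` of a linear connection at a point `x` of a chart `φ`. They exist
because the connection and the flat connection of `φ` differ by a tensor. -/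
theorem IsSmoothChart.exists_christoffel {φ : OpenPartialHomeomorph N W}
    (hφ : IsSmoothChart (W := W) φ)
    (cov : CovariantDerivative 𝓘(ℝ, W) W (TangentSpace 𝓘(ℝ, W) : N → Type _)) {x : N}
    (hx : x ∈ φ.source) :
    ∃ G : W →L[ℝ] W →L[ℝ] W, ∀ Z : ∀ x : N, TangentSpace 𝓘(ℝ, W) x, MDiffAt (T% Z) x →
      ∀ v, chartDeriv φ x (cov Z x v) = fderiv ℝ (coordField φ Z) (φ x) (chartDeriv φ x v) +
        G (chartDeriv φ x v) (chartDeriv φ x (Z x)) := by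
  have : IsManifold 𝓘(ℝ, W) 1 N := .of_le (n := ∞) (by norm_cast)
  have : IsManifold 𝓘(ℝ, W) 2 N := .of_le (n := ∞) (by norm_cast)
  have : CompleteSpace W := FiniteDimensional.complete ℝ W
  let D := (cov.isCovariantDerivativeOn (s := φ.source)).difference
    hφ.isCovariantDerivativeOn_flatDeriv x
  refine ⟨(LinearMap.mk₂ ℝ (fun v w ↦ chartDeriv φ x (D (chartDerivInv φ x w)
    (chartDerivInv φ x v))) ?_ ?_ ?_ ?_).toContinuousBilinearMap, fun Z hZ v ↦ ?_⟩
  · intros; simp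
  · intros; simp
  · intros; simp
  · intros; simp
  · rw [LinearMap.toContinuousBilinearMap_apply, LinearMap.mk₂_apply,
      hφ.chartDerivInv_chartDeriv hx, hφ.chartDerivInv_chartDeriv hx,
      IsCovariantDerivativeOn.difference_apply _ _ hx hZ, sub_apply, map_sub,
      hφ.chartDeriv_flatDeriv hx]
    abel

/-- The coordinate vector fields of a chart can be cut off to global smooth fields without changing
them near `x₀`. This is needed since smoothness and flatness of a connection are expressed in terms
of global smooth vector fields. -/
theorem exists_local_constant_frame [T2Space N] (x₀ : N) :
    ∃ U : Set N, IsOpen U ∧ x₀ ∈ U ∧ U ⊆ (chartAt W x₀).source ∧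
      ∃ Y : W → ∀ x : N, TangentSpace 𝓘(ℝ, W) x, ∀ w, CMDiff ∞ (T% (Y w)) ∧
        ∀ x ∈ U, Y w x = chartDerivInv (chartAt W x₀) x w := by
  have hφ : IsSmoothChart (W := W) (chartAt W x₀) :=
    ⟨contMDiffOn_chart, contMDiffOn_chart_symm⟩
  obtain ⟨f⟩ : Nonempty (SmoothBumpFunction 𝓘(ℝ, W) x₀) := inferInstance
  set φ := chartAt W x₀
  obtain ⟨U, hU, hUo, hxU⟩ := eventually_nhds_iff.1 f.eventuallyEq_one
  refine ⟨U ∩ φ.source, hUo.inter φ.open_source, ⟨hxU, mem_chart_source W x₀⟩, inter_subset_right,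
    fun w ↦ (f : N → ℝ) • fun x ↦ chartDerivInv φ x w, fun w ↦ ⟨?_, fun x hx ↦ ?_⟩⟩
  · refine ContMDiffOn.smul_section_of_tsupport f.contMDiff.contMDiffOn φ.open_source
      f.tsupport_subset_chartAt_source fun x hx ↦ ContMDiffAt.contMDiffWithinAt ?_
    refine hφ.contMDiffAt_of_coordField hx (contDiffAt_const (c := w)
      |>.congr_of_eventuallyEq ?_)
    filter_upwards [φ.open_target.mem_nhds (φ.map_source hx)] with u hu
    exact hφ.chartDeriv_chartDerivInv (φ.map_target hu) w
  · have := hU x hx.1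
    simp [this]

end ConnectionForm

section FlatConnection

variable {E : Type*} [NormedAddCommGroup E] [NormedSpace ℝ E] [FiniteDimensional ℝ E]
  {M : Type*} [TopologicalSpace M] [ChartedSpace E M] [IsManifold 𝓘(ℝ, E) ∞ M]
  {cov : CovariantDerivative 𝓘(ℝ, E) E (TangentSpace 𝓘(ℝ, E) : M → Type _)}

/-- Around every point, a curvature-free symmetric connection is the flat connection of a suitable
chart: its Christoffel symbols in any chart are symmetric and flat, so that
`exists_affine_coordinates` applies. -/
theorem IsFlatSymmetricConnection.exists_affine_chart [T2Space M]
    (h : IsFlatSymmetricConnection cov) (x₀ : M) :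
    ∃ f : OpenPartialHomeomorph M E, x₀ ∈ f.source ∧ IsSmoothChart (W := E) f ∧
      ∀ x ∈ f.source, ∀ Z : ∀ x : M, TangentSpace 𝓘(ℝ, E) x, MDiffAt (T% Z) x →
        flatDeriv f Z x = cov Z x := by
  have : CompleteSpace E := FiniteDimensional.complete ℝ E
  have hφ : IsSmoothChart (W := E) (chartAt E x₀) :=
    ⟨contMDiffOn_chart, contMDiffOn_chart_symm⟩
  obtain ⟨U, hUo, hxU, hUs, Y, hY⟩ := exists_local_constant_frame (W := E) x₀
  set φ := chartAt E x₀
  have hG' : ∀ u : E, ∃ G : E →L[ℝ] E →L[ℝ] E, u ∈ φ.target →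
      ∀ Z : ∀ x : M, TangentSpace 𝓘(ℝ, E) x, MDiffAt (T% Z) (φ.symm u) →
      ∀ v, chartDeriv φ (φ.symm u) (cov Z (φ.symm u) v) =
        fderiv ℝ (coordField φ Z) u (chartDeriv φ (φ.symm u) v) +
        G (chartDeriv φ (φ.symm u) v) (chartDeriv φ (φ.symm u) (Z (φ.symm u))) := fun u ↦ by
    by_cases hu : u ∈ φ.target
    · obtain ⟨G, hG⟩ := hφ.exists_christoffel cov (φ.map_target hu)
      rw [φ.right_inv hu] at hG
      exact ⟨G, fun _ ↦ hG⟩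
    · exact ⟨0, fun h ↦ (hu h).elim⟩
  choose Γ hΓ' using hG'
  have hΓ : ∀ x ∈ φ.source, ∀ Z : ∀ x : M, TangentSpace 𝓘(ℝ, E) x, MDiffAt (T% Z) x →
      ∀ v, chartDeriv φ x (cov Z x v) = fderiv ℝ (coordField φ Z) (φ x) (chartDeriv φ x v) +
        Γ (φ x) (chartDeriv φ x v) (chartDeriv φ x (Z x)) := fun x hx Z hZ v ↦ by
    have h1 := hΓ' (φ x) (φ.map_source hx)
    rw [φ.left_inv hx] at h1
    exact h1 Z hZ v
  -- the domain of the chart in coordinates on which the frame `Y` is constant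
  set T : Set E := φ.target ∩ φ.symm ⁻¹' U
  have hTo : IsOpen T := φ.isOpen_inter_preimage_symm hUo
  have hmem : ∀ x ∈ U, φ x ∈ T := fun x hx ↦
    ⟨φ.map_source (hUs hx), by rwa [mem_preimage, φ.left_inv (hUs hx)]⟩
  have hYd : ∀ w x, MDiffAt (T% (Y w)) x := fun w x ↦ ((hY w).1 x).mdifferentiableAt (by simp)
  have hYU : ∀ w, ∀ x ∈ U, chartDeriv φ x (Y w x) = w := fun w x hx ↦ by
    rw [(hY w).2 x hx, hφ.chartDeriv_chartDerivInv (hUs hx)]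
  have hYT : ∀ w, ∀ u ∈ T, coordField φ (Y w) u = w := fun w u hu ↦ hYU w _ hu.2
  have hYev : ∀ w, ∀ u ∈ T, coordField φ (Y w) =ᶠ[𝓝 u] fun _ ↦ w := fun w u hu ↦ by
    filter_upwards [hTo.mem_nhds hu] with u hu using hYT w u hu
  have hYfd : ∀ w, ∀ u ∈ T, fderiv ℝ (coordField φ (Y w)) u = 0 := fun w u hu ↦ by
    rw [(hYev w u hu).fderiv_eq, fderiv_const_apply]
  have hΓY : ∀ v w, ∀ x ∈ U, chartDeriv φ x (cov (Y w) x (Y v x)) = Γ (φ x) v w :=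
    fun v w x hx ↦ by
    rw [hΓ x (hUs hx) _ (hYd w x), hYfd w _ (hmem x hx), hYU v x hx, hYU w x hx]
    simp
  have hS : ∀ v w, CMDiff ∞ (T% (fun x ↦ cov (Y w) x (Y v x))) := fun v w x ↦ by
    have h1 := contMDiffOn_univ.1 (h.smooth.contMDiff.contMDiff (σ := Y w)
      (contMDiffOn_univ.2 (hY w).1))
    exact ContMDiffAt.clm_bundle_apply (h1 x) ((hY v).1 x)
  have hSΓ : ∀ v w, ∀ u ∈ T, coordField φ (fun x ↦ cov (Y w) x (Y v x)) u = Γ u v w :=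
    fun v w u hu ↦ by
    have := hΓY v w _ hu.2
    rwa [φ.right_inv hu.1] at this
  have hΓs : ContDiffOn ℝ ∞ Γ T := by
    refine contDiffOn_clm_apply.2 fun v ↦ contDiffOn_clm_apply.2 fun w u hu ↦ ?_
    refine ContDiffAt.contDiffWithinAt (ContDiffAt.congr_of_eventuallyEq
      (f := coordField φ (fun x ↦ cov (Y w) x (Y v x))) ?_ ?_)
    · have := hφ.contDiffAt_coordField (hUs hu.2) (hS v w (φ.symm u))
      rwa [φ.right_inv hu.1] at this
    · filter_upwards [hTo.mem_nhds hu] with u hu using (hSΓ v w u hu).symm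
  have hbr : ∀ v w, ∀ x ∈ U, VectorField.mlieBracket 𝓘(ℝ, E) (Y v) (Y w) x = 0 :=
    fun v w x hx ↦ by
    apply hφ.chartDeriv_injective (hUs hx)
    rw [hφ.chartDeriv_mlieBracket (hUs hx) (hYd v x) (hYd w x), hYfd w _ (hmem x hx),
      hYfd v _ (hmem x hx)]
    simp
  have hsymm : ∀ u ∈ T, ∀ v w, Γ u v w = Γ u w v := fun u hu v w ↦ by
    have h1 := (CovariantDerivative.torsion_eq_zero_iff cov).1 h.symmetric (hYd v (φ.symm u))
      (hYd w (φ.symm u))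
    rw [hbr v w _ hu.2, sub_eq_zero] at h1
    have h2 := congrArg (chartDeriv φ (φ.symm u)) h1
    rwa [hΓY v w _ hu.2, hΓY w v _ hu.2, φ.right_inv hu.1] at h2
  have hΓd : ∀ u ∈ T, DifferentiableAt ℝ Γ u := fun u hu ↦
    (hΓs.contDiffAt (hTo.mem_nhds hu)).differentiableAt (by simp)
  have hcc : ∀ a b c, ∀ u ∈ T, chartDeriv φ (φ.symm u)
      (cov (fun x ↦ cov (Y c) x (Y b x)) (φ.symm u) (Y a (φ.symm u))) =
        fderiv ℝ Γ u a b c + Γ u a (Γ u b c) := fun a b c u hu ↦ by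
    rw [hΓ _ (hUs hu.2) _ (((hS b c) _).mdifferentiableAt (by simp)), hYU a _ hu.2, hΓY b c _ hu.2,
      φ.right_inv hu.1]
    have hev : coordField φ (fun x ↦ cov (Y c) x (Y b x)) =ᶠ[𝓝 u] fun u ↦ Γ u b c := by
      filter_upwards [hTo.mem_nhds hu] with u hu using hSΓ b c u hu
    have hd := ((hΓd u hu).hasFDerivAt.clm_apply (hasFDerivAt_const b u)).clm_apply
      (hasFDerivAt_const c u)
    rw [hev.fderiv_eq, hd.fderiv]
    simp
  have hflat : ∀ u ∈ T, ∀ a b c, fderiv ℝ Γ u a b c - fderiv ℝ Γ u b a c + Γ u a (Γ u b c) -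
      Γ u b (Γ u a c) = 0 := fun u hu a b c ↦ by
    have h1 := congrArg (chartDeriv φ (φ.symm u))
      (h.curvature_free (Y a) (Y b) (Y c) (hY a).1 (hY b).1 (hY c).1 (φ.symm u))
    rw [linearCurvature, hbr a b _ hu.2, map_zero, map_sub, map_sub, hcc a b c u hu,
      hcc b a c u hu, map_zero, sub_zero] at h1
    rw [← h1]
    abel
  obtain ⟨F, hF0, hFs, hFd, hFd', hF⟩ := exists_affine_coordinates hTo hΓs hsymm hflat
    (hmem x₀ hxU)
  have hfsrc : ∀ x, x ∈ (φ ≫ₕ F).source ↔ x ∈ φ.source ∧ φ x ∈ F.source := fun x ↦ by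
    simp
  have hf : IsSmoothChart (W := E) (φ ≫ₕ F) := by
    constructor
    · have hs : ContMDiffOn 𝓘(ℝ, E) 𝓘(ℝ, E) ∞ φ (φ ≫ₕ F).source :=
        hφ.smooth.mono fun x hx ↦ ((hfsrc x).1 hx).1
      exact hFd.contMDiffOn.comp hs fun x hx ↦ ((hfsrc x).1 hx).2
    · have ht : ∀ u ∈ (φ ≫ₕ F).target, u ∈ F.target ∧ F.symm u ∈ φ.target := fun u hu ↦ by
        simpa [OpenPartialHomeomorph.trans_target] using hu
      have hs : ContMDiffOn 𝓘(ℝ, E) 𝓘(ℝ, E) ∞ F.symm (φ ≫ₕ F).target :=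
        hFd'.contMDiffOn.mono fun u hu ↦ (ht u hu).1
      exact hφ.smooth_symm.comp hs fun u hu ↦ (ht u hu).2
  refine ⟨φ ≫ₕ F, (hfsrc _).2 ⟨hUs hxU, hF0⟩, hf, fun x hx Z hZ ↦ ?_⟩
  obtain ⟨hx1, hx2⟩ := (hfsrc x).1 hx
  have hev : (φ ≫ₕ F) ∘ φ.symm =ᶠ[𝓝 (φ x)] F := by
    filter_upwards [φ.open_target.mem_nhds (φ.map_source hx1)] with u hu
    simp [φ.right_inv hu]
  have hD : ∀ v : TangentSpace 𝓘(ℝ, E) x,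
      chartDeriv (φ ≫ₕ F) x v = fderiv ℝ F (φ x) (chartDeriv φ x v) := fun v ↦ by
    rw [← hφ.fderiv_transition hf hx1 hx v, hev.fderiv_eq]
  ext v
  apply hf.chartDeriv_injective hx
  rw [hφ.chartDeriv_flatDeriv_eq_add hf hx1 hx hZ v, hev.fderiv.fderiv_eq, hF _ hx2, hD, hD,
    hΓ x hx1 Z hZ v, hφ.chartDeriv_flatDeriv hx1, map_add]

theorem IsFlatSymmetricConnection.exists_isAffineAtlas [T2Space M]
    (h : IsFlatSymmetricConnection cov) :
    ∃ B : Set (OpenPartialHomeomorph M E), IsAffineAtlas (W := E) B := by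
  refine ⟨{f | IsSmoothChart (W := E) f ∧ ∀ x ∈ f.source, ∀ Z : ∀ x : M, TangentSpace 𝓘(ℝ, E) x,
    MDiffAt (T% Z) x → flatDeriv f Z x = cov Z x}, fun f hf ↦ hf.1, fun x ↦ ?_,
    fun φ hφ ψ hψ x hx ↦ ?_⟩
  · obtain ⟨f, h1, h2, h3⟩ := h.exists_affine_chart x
    exact ⟨f, ⟨h2, h3⟩, h1⟩
  · ext v w
    have : IsManifold 𝓘(ℝ, E) 1 M := .of_le (n := ∞) (by norm_cast)
    have hZ : MDiffAt (T% (FiberBundle.extend E (chartDerivInv (W := E) φ x w))) x :=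
      FiberBundle.mdifferentiableAt_extend ..
    have h1 := hφ.1.chartDeriv_flatDeriv_eq_add hψ.1 hx.1 hx.2 hZ (chartDerivInv φ x v)
    rw [hφ.2 x hx.1 _ hZ, hψ.2 x hx.2 _ hZ, left_eq_add, FiberBundle.extend_apply_self,
      hφ.1.chartDeriv_chartDerivInv hx.1, hφ.1.chartDeriv_chartDerivInv hx.1] at h1
    simpa using h1

end FlatConnection

/-! ### The spray of straight lines of a chart -/

section Spray

variable {W : Type*} [NormedAddCommGroup W] [NormedSpace ℝ W]
  {N : Type*} [TopologicalSpace N] [ChartedSpace W N] [IsManifold 𝓘(ℝ, W) ∞ N]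
  {V : Type*} [NormedAddCommGroup V] [NormedSpace ℝ V]

/-- The differential `T_v(TN) → V × V` of the coordinates `(q, q̇)`. -/
noncomputable def tangentCoordDeriv (φ : OpenPartialHomeomorph N V)
    (v : TangentBundle 𝓘(ℝ, W) N) : TangentSpace 𝓘(ℝ, W).tangent v →L[ℝ] V × V :=
  mfderiv 𝓘(ℝ, W).tangent 𝓘(ℝ, V × V) (tangentCoord φ) v

/-- The spray of straight lines in the coordinates `q = φ`: the vector field `q̇ ∂/∂q` on `TN`,
which expresses the equation `q̈ = 0`. -/
noncomputable def lineSpray (φ : OpenPartialHomeomorph N V) (v : TangentBundle 𝓘(ℝ, W) N) :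
    TangentSpace 𝓘(ℝ, W).tangent v :=
  mfderiv 𝓘(ℝ, V × V) 𝓘(ℝ, W).tangent (tangentCoordSymm (W := W) φ) (tangentCoord φ v)
    ((chartDeriv φ v.proj v.2, 0) : V × V)

namespace IsSmoothChart

variable {φ ψ : OpenPartialHomeomorph N V}

theorem mdifferentiableAt_tangentCoord (hφ : IsSmoothChart (W := W) φ)
    {v : TangentBundle 𝓘(ℝ, W) N} (hv : v.proj ∈ φ.source) :
    MDifferentiableAt 𝓘(ℝ, W).tangent 𝓘(ℝ, V × V) (tangentCoord φ) v :=
  (hφ.contMDiffOn_tangentCoord.contMDiffAt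
    ((φ.open_source.preimage (FiberBundle.continuous_proj _ _)).mem_nhds hv)).mdifferentiableAt
      (by simp)

theorem mdifferentiableAt_tangentCoordSymm (hφ : IsSmoothChart (W := W) φ)
    {p : V × V} (hp : p.1 ∈ φ.target) :
    MDifferentiableAt 𝓘(ℝ, V × V) 𝓘(ℝ, W).tangent (tangentCoordSymm (W := W) φ) p :=
  (hφ.contMDiffOn_tangentCoordSymm.contMDiffAt
    ((φ.open_target.preimage continuous_fst).mem_nhds hp)).mdifferentiableAt (by simp)

theorem mfderiv_of_eventuallyEq_comp_tangentCoord (hφ : IsSmoothChart (W := W) φ)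
    {v : TangentBundle 𝓘(ℝ, W) N} (hv : v.proj ∈ φ.source) (η : TangentSpace 𝓘(ℝ, W).tangent v)
    {G : Type*} [NormedAddCommGroup G] [NormedSpace ℝ G] (L : V × V →L[ℝ] G)
    (g : TangentBundle 𝓘(ℝ, W) N → G) (hg : g =ᶠ[𝓝 v] L ∘ tangentCoord φ) :
    (mfderiv 𝓘(ℝ, W).tangent 𝓘(ℝ, G) g v η : G) = L (tangentCoordDeriv φ v η) := by
  rw [hg.mfderiv_eq, mfderiv_comp v L.differentiableAt.mdifferentiableAt
    (hφ.mdifferentiableAt_tangentCoord hv), mfderiv_eq_fderiv, L.fderiv]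
  rfl

theorem tangentCoordDeriv_lineSpray (hφ : IsSmoothChart (W := W) φ)
    {v : TangentBundle 𝓘(ℝ, W) N} (hv : v.proj ∈ φ.source) :
    tangentCoordDeriv φ v (lineSpray φ v) = (chartDeriv φ v.proj v.2, 0) := by
  have hu : (tangentCoord φ v).1 ∈ φ.target := φ.map_source hv
  have h1 := mfderiv_comp_of_eq (x := tangentCoord φ v) (y := v)
    (hφ.mdifferentiableAt_tangentCoord hv)
    (hφ.mdifferentiableAt_tangentCoordSymm hu) (hφ.tangentCoordSymm_tangentCoord hv)
  rw [hφ.tangentCoordSymm_tangentCoord hv] at h1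
  have h2 : (tangentCoord φ ∘ tangentCoordSymm (W := W) φ) =ᶠ[𝓝 (tangentCoord φ v)] id := by
    filter_upwards [(φ.open_target.preimage continuous_fst).mem_nhds hu] with z hz
      using hφ.tangentCoord_tangentCoordSymm hz
  rw [h2.mfderiv_eq, mfderiv_id] at h1
  exact (congrArg (fun T ↦ T (chartDeriv φ v.proj v.2, (0 : V))) h1).symm

/-- A vector tangent to `TN` is determined by its components `(q̇, 0)`. -/
theorem eq_lineSpray (hφ : IsSmoothChart (W := W) φ)
    {v : TangentBundle 𝓘(ℝ, W) N} (hv : v.proj ∈ φ.source)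
    {η : TangentSpace 𝓘(ℝ, W).tangent v}
    (h : tangentCoordDeriv φ v η = (chartDeriv φ v.proj v.2, 0)) : η = lineSpray φ v := by
  have hu : (tangentCoord φ v).1 ∈ φ.target := φ.map_source hv
  have h1 := mfderiv_comp v (hφ.mdifferentiableAt_tangentCoordSymm hu)
    (hφ.mdifferentiableAt_tangentCoord hv)
  have h2 : (tangentCoordSymm (W := W) φ ∘ tangentCoord φ) =ᶠ[𝓝 v] id := by
    filter_upwards [(φ.open_source.preimage (FiberBundle.continuous_proj _ _)).mem_nhds hv]
      with z hz using hφ.tangentCoordSymm_tangentCoord hz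
  rw [h2.mfderiv_eq, mfderiv_id] at h1
  have h3 := congrArg (fun T ↦ T η) h1
  rw [lineSpray, ← h]
  exact h3

theorem contMDiffOn_lineSpray (hφ : IsSmoothChart (W := W) φ) :
    ContMDiffOn 𝓘(ℝ, W).tangent 𝓘(ℝ, W).tangent.tangent ∞
      (fun v ↦ (⟨v, lineSpray φ v⟩ : TangentBundle 𝓘(ℝ, W).tangent (TangentBundle 𝓘(ℝ, W) N)))
      {v | v.proj ∈ φ.source} := by
  have hop : IsOpen {p : V × V | p.1 ∈ φ.target} := φ.open_target.preimage continuous_fst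
  have : IsManifold 𝓘(ℝ, W).tangent 1 (TangentBundle 𝓘(ℝ, W) N) :=
    .of_le (n := ∞) (by norm_cast)
  have h1 := hφ.contMDiffOn_tangentCoordSymm.contMDiffOn_tangentMapWithin (m := ∞) le_rfl
    hop.uniqueMDiffOn
  have h2 : ContMDiffOn 𝓘(ℝ, W).tangent 𝓘(ℝ, (V × V) × (V × V)) ∞
      (fun v : TangentBundle 𝓘(ℝ, W) N ↦ (tangentCoord φ v, ((tangentCoord φ v).2, (0 : V))))
      {v | v.proj ∈ φ.source} := by
    have h3 : ContDiff ℝ ∞ (fun p : V × V ↦ (p, (p.2, (0 : V)))) := by fun_prop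
    exact h3.contMDiff.comp_contMDiffOn hφ.contMDiffOn_tangentCoord
  have h4 := contMDiff_mk_tangentBundle_modelSpace.comp_contMDiffOn h2
  refine (h1.comp h4 fun v hv ↦ φ.map_source hv).congr fun v hv ↦ ?_
  have hu : tangentCoord φ v ∈ {p : V × V | p.1 ∈ φ.target} := φ.map_source hv
  have h5 := hφ.tangentCoordSymm_tangentCoord hv
  simp only [Function.comp, tangentMapWithin]
  rw [mfderivWithin_of_isOpen hop hu]
  refine Bundle.TotalSpace.ext h5.symm (heq_of_eq rfl)

/-- Under a change of coordinates `τ` the components `(q̇, 0)` of a vector tangent to `TN` become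
`(q̇', D²τ(q̇, q̇))`: the equation `q̈ = 0` becomes `q̈' = D²τ(q̇, q̇)`. -/
theorem tangentCoordDeriv_transition (hφ : IsSmoothChart (W := W) φ)
    (hψ : IsSmoothChart (W := W) ψ) {v : TangentBundle 𝓘(ℝ, W) N} (hv : v.proj ∈ φ.source)
    (hv' : v.proj ∈ ψ.source) {η : TangentSpace 𝓘(ℝ, W).tangent v}
    (h : tangentCoordDeriv φ v η = (chartDeriv φ v.proj v.2, 0)) :
    tangentCoordDeriv ψ v η = (chartDeriv ψ v.proj v.2,
      fderiv ℝ (fderiv ℝ (ψ ∘ φ.symm)) (φ v.proj) (chartDeriv φ v.proj v.2)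
        (chartDeriv φ v.proj v.2)) := by
  set τ : V → V := ψ ∘ φ.symm with hτ
  set T : V × V → V × V := fun p ↦ (τ p.1, fderiv ℝ τ p.1 p.2) with hT
  have hτd : ContDiffAt ℝ ∞ τ (φ v.proj) := hφ.contDiffAt_transition hψ hv hv'
  have hτd' : DifferentiableAt ℝ (fderiv ℝ τ) (φ v.proj) :=
    (hτd.fderiv_right (m := ∞) le_rfl).differentiableAt (by simp)
  have hev : tangentCoord ψ =ᶠ[𝓝 v] T ∘ tangentCoord φ := by
    filter_upwards [((φ.open_source.inter ψ.open_source).preimage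
      (FiberBundle.continuous_proj W (TangentSpace 𝓘(ℝ, W)))).mem_nhds ⟨hv, hv'⟩] with z hz
    simp only [hT, hτ, tangentCoord, Function.comp, φ.left_inv hz.1]
    exact congrArg (Prod.mk _) (hφ.fderiv_transition hψ hz.1 hz.2 z.2).symm
  set p : V × V := tangentCoord φ v
  have hTd : HasFDerivAt T (((fderiv ℝ τ p.1).comp (ContinuousLinearMap.fst ℝ V V)).prod
      ((fderiv ℝ τ p.1).comp (ContinuousLinearMap.snd ℝ V V) +
        ((fderiv ℝ (fderiv ℝ τ) p.1).comp (ContinuousLinearMap.fst ℝ V V)).flip p.2)) p := by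
    refine HasFDerivAt.prodMk ?_ ?_
    · exact HasFDerivAt.comp p (f := Prod.fst) (hτd.differentiableAt (by simp)).hasFDerivAt
        hasFDerivAt_fst
    · have h1 : HasFDerivAt (fun p : V × V ↦ fderiv ℝ τ p.1)
          ((fderiv ℝ (fderiv ℝ τ) p.1).comp (ContinuousLinearMap.fst ℝ V V)) p :=
        HasFDerivAt.comp p (f := Prod.fst) hτd'.hasFDerivAt hasFDerivAt_fst
      exact h1.clm_apply hasFDerivAt_snd
  have h1 : tangentCoordDeriv ψ v η = fderiv ℝ T p (tangentCoordDeriv φ v η) := by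
    simp only [tangentCoordDeriv]
    rw [hev.mfderiv_eq, mfderiv_comp v hTd.differentiableAt.mdifferentiableAt
      (hφ.mdifferentiableAt_tangentCoord hv), mfderiv_eq_fderiv]
    rfl
  have h2 := hφ.fderiv_transition hψ hv hv' v.2
  rw [← hτ] at h2
  rw [h1, h, hTd.fderiv, ← h2]
  simp [p, tangentCoord]

end IsSmoothChart

end Spray

/-! ### Free motion equations in bundle coordinates -/

section DynamicEquationCoordinates

variable {F : Type*} [NormedAddCommGroup F] [NormedSpace ℝ F]
  {Q : Type*} [TopologicalSpace Q] [ChartedSpace F Q]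
  {E : Type*} [NormedAddCommGroup E] [NormedSpace ℝ E]
  {π : Q → ℝ} {φ ψ : OpenPartialHomeomorph Q (ℝ × E)}

namespace IsBundleChart

theorem isSmoothChart (hφ : IsBundleChart (F := F) π φ) : IsSmoothChart (W := F) φ :=
  ⟨hφ.smooth, hφ.smooth_symm⟩

theorem timeRate_eq (hφ : IsBundleChart (F := F) π φ) {v : TangentBundle 𝓘(ℝ, F) Q}
    (hv : v.proj ∈ φ.source) : timeRate π v = (chartDeriv φ v.proj v.2).1 := by
  have h1 : π =ᶠ[𝓝 v.proj] Prod.fst ∘ φ := by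
    filter_upwards [φ.open_source.mem_nhds hv] with x hx using (hφ.time x hx).symm
  simp only [timeRate]
  rw [h1.mfderiv_eq, mfderiv_comp v.proj differentiableAt_fst.mdifferentiableAt
    (hφ.isSmoothChart.mdifferentiableAt hv), mfderiv_eq_fderiv, fderiv_fst]
  rfl

variable [IsManifold 𝓘(ℝ, F) ∞ Q]

/-- In the coordinates `(t, q, ṫ, q̇)` on `TQ`, a vector `η` tangent to `TQ` is given by its
projection to `TQ` and by the derivatives along `η` of `ṫ` and of the jet coordinates. -/
theorem tangentCoordDeriv_eq (hφ : IsBundleChart (F := F) π φ)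
    {v : TangentBundle 𝓘(ℝ, F) Q} (hv : v.proj ∈ φ.source)
    (η : TangentSpace 𝓘(ℝ, F).tangent v) :
    tangentCoordDeriv φ v η = (chartDeriv φ v.proj (mfderiv 𝓘(ℝ, F).tangent 𝓘(ℝ, F)
        (fun w : TangentBundle 𝓘(ℝ, F) Q ↦ w.proj) v η),
      ((mfderiv 𝓘(ℝ, F).tangent 𝓘(ℝ, ℝ) (timeRate π) v η : ℝ),
        (mfderiv 𝓘(ℝ, F).tangent 𝓘(ℝ, E) (jetCoord φ) v η : E))) := by
  have hφ' := hφ.isSmoothChart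
  have hnhds : ∀ᶠ w : TangentBundle 𝓘(ℝ, F) Q in 𝓝 v, w.proj ∈ φ.source :=
    (φ.open_source.preimage (FiberBundle.continuous_proj F (TangentSpace 𝓘(ℝ, F)))).mem_nhds hv
  refine Prod.ext ?_ (Prod.ext ?_ ?_)
  · have hp : MDifferentiableAt 𝓘(ℝ, F).tangent 𝓘(ℝ, F)
        (fun w : TangentBundle 𝓘(ℝ, F) Q ↦ w.proj) v :=
      (Bundle.contMDiff_proj (n := ∞) _ v).mdifferentiableAt (by simp)
    have h1 := hφ'.mfderiv_of_eventuallyEq_comp_tangentCoord hv η (ContinuousLinearMap.fst ℝ _ _)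
      (fun w : TangentBundle 𝓘(ℝ, F) Q ↦ φ w.proj) (Eventually.of_forall fun w ↦ rfl)
    have h2 := mfderiv_comp (I' := 𝓘(ℝ, F)) v (hφ.isSmoothChart.mdifferentiableAt hv) hp
    exact h1.symm.trans (congrArg (fun T ↦ T η) h2)
  · refine (hφ'.mfderiv_of_eventuallyEq_comp_tangentCoord hv η
      ((ContinuousLinearMap.fst ℝ _ _).comp (ContinuousLinearMap.snd ℝ _ _))
      (timeRate π) ?_).symm
    filter_upwards [hnhds] with w hw using hφ.timeRate_eq hw
  · exact (hφ'.mfderiv_of_eventuallyEq_comp_tangentCoord hv η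
      ((ContinuousLinearMap.snd ℝ _ _).comp (ContinuousLinearMap.snd ℝ _ _))
      (jetCoord φ) (Eventually.of_forall fun w ↦ rfl)).symm

/-- In the coordinates of a bundle chart, a dynamic equation reads `qₜₜ = 0` at `v` if and only if
it is the spray of straight lines. -/
theorem rhs_eq_zero_iff (hφ : IsBundleChart (F := F) π φ) (ξ : DynamicEquation (F := F) π)
    {v : TangentBundle 𝓘(ℝ, F) Q} (hv : v ∈ jetSpace π) (hvφ : v.proj ∈ φ.source) :
    ξ.rhs φ v = 0 ↔ tangentCoordDeriv φ v (ξ.field v) = (chartDeriv φ v.proj v.2, 0) := by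
  rw [hφ.tangentCoordDeriv_eq hvφ, ξ.holonomic v hv, ξ.tangent v hv]
  exact ⟨fun h ↦ Prod.ext rfl (Prod.ext rfl h), fun h ↦ (Prod.ext_iff.1 (Prod.ext_iff.1 h).2).2⟩

end IsBundleChart

/-- A symmetric bilinear map on `ℝ × E` which vanishes on the diagonal over the affine hyperplane
of vectors with time component `1` vanishes: this hyperplane determines a quadratic form. -/
theorem eq_zero_of_apply_self_eq_zero {B : ℝ × E →L[ℝ] ℝ × E →L[ℝ] ℝ × E}
    (hB : ∀ v w, B v w = B w v) (h : ∀ w, w.1 = 1 → B w w = 0) : B = 0 := by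
  have h0 : ∀ y : E, B (0, y) (0, y) = 0 ∧ B (1, 0) (0, y) = 0 := fun y ↦ by
    -- a quadratic polynomial in `c` which vanishes identically, at `c = 0, 1, -1` in particular
    have e : ∀ c : ℝ, B (1, 0) (1, 0) + (2 * c) • B (1, 0) (0, y) +
        (c * c) • B (0, y) (0, y) = 0 := fun c ↦ by
      have h1 := h ((1, 0) + c • (0, y)) (by simp)
      simp only [map_add, map_smul, add_apply, smul_apply, hB (0, y) (1, 0)] at h1
      rw [← h1]
      module
    have e0 := e 0
    have e1 := e 1
    have e2 := e (-1)
    simp only [mul_zero, zero_smul, add_zero] at e0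
    rw [e0] at e1 e2
    have e3 : (2 : ℝ) • B (0, y) (0, y) = 0 := by
      have := congrArg₂ (· + ·) e1 e2
      rw [add_zero] at this
      rw [← this]
      module
    have e4 : B (0, y) (0, y) = 0 := by simpa using e3
    rw [e4] at e1
    exact ⟨e4, by simpa using e1⟩
  have h1 : ∀ y z : E, B (0, y) (0, z) = 0 := fun y z ↦ by
    have e := (h0 (y + z)).1
    have e1 : ((0 : ℝ), y + z) = (0, y) + (0, z) := by simp
    rw [e1] at e
    simp only [map_add, add_apply, (h0 y).1, (h0 z).1, hB (0, z) (0, y)] at e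
    have : (2 : ℝ) • B (0, y) (0, z) = 0 := by
      rw [← e]
      module
    simpa using this
  have h2 : B (1, 0) (1, 0) = 0 := h _ rfl
  have h3 : ∀ p : ℝ × E, p = p.1 • (1, 0) + (0, p.2) := fun p ↦ by ext <;> simp
  refine ContinuousLinearMap.ext fun v ↦ ContinuousLinearMap.ext fun w ↦ ?_
  rw [h3 v, h3 w]
  simp only [map_add, map_smul, add_apply, smul_apply, h1, h2, (h0 _).2, hB (0, _) (1, 0)]
  simp

variable [IsManifold 𝓘(ℝ, F) ∞ Q]

/-- The transition maps between coordinates in which a dynamic equation reads `qₜₜ = 0` are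
affine. -/
theorem DynamicEquation.fderiv_fderiv_transition_eq_zero (ξ : DynamicEquation (F := F) π)
    (hφ : IsBundleChart (F := F) π φ) (hψ : IsBundleChart (F := F) π ψ)
    (hφξ : ∀ v ∈ jetSpace π, v.proj ∈ φ.source → ξ.rhs φ v = 0)
    (hψξ : ∀ v ∈ jetSpace π, v.proj ∈ ψ.source → ξ.rhs ψ v = 0) {x : Q} (hx : x ∈ φ.source)
    (hx' : x ∈ ψ.source) : fderiv ℝ (fderiv ℝ (ψ ∘ φ.symm)) (φ x) = 0 := by
  have hs : IsSymmSndFDerivAt ℝ (ψ ∘ φ.symm) (φ x) :=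
    (hφ.isSmoothChart.contDiffAt_transition hψ.isSmoothChart hx hx').isSymmSndFDerivAt
      (by rw [minSmoothness_of_isRCLikeNormedField]; norm_cast)
  refine eq_zero_of_apply_self_eq_zero hs.eq fun w hw ↦ ?_
  set v : TangentBundle 𝓘(ℝ, F) Q := ⟨x, chartDerivInv φ x w⟩
  have hvw : chartDeriv φ v.proj v.2 = w := hφ.isSmoothChart.chartDeriv_chartDerivInv hx w
  have hv : v ∈ jetSpace π := by
    change timeRate π v = 1
    rw [hφ.timeRate_eq hx, hvw, hw]
  have h1 := (hφ.rhs_eq_zero_iff ξ hv hx).1 (hφξ v hv hx)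
  have h2 := (hψ.rhs_eq_zero_iff ξ hv hx').1 (hψξ v hv hx')
  have h3 := hφ.isSmoothChart.tangentCoordDeriv_transition hψ.isSmoothChart (v := v) hx hx' h1
  rw [h2, hvw] at h3
  exact (Prod.ext_iff.1 h3).2.symm

/-- If a reference frame is an affine atlas, then the sprays of straight lines of its charts agree
on overlaps and define a free motion equation. -/
theorem exists_isFreeMotion_of_isAffineAtlas {A : Set (OpenPartialHomeomorph Q (ℝ × E))}
    (hA : IsReferenceFrame (F := F) π A) (haff : IsAffineAtlas (W := F) A) :
    ∃ ξ : DynamicEquation (F := F) π, ξ.IsFreeMotion E := by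
  choose c hcA hc using hA.covers
  have hs := haff.isSmoothChart
  have hfield : ∀ φ ∈ A, ∀ v : TangentBundle 𝓘(ℝ, F) Q, v.proj ∈ φ.source →
      tangentCoordDeriv φ v (lineSpray (c v.proj) v) = (chartDeriv φ v.proj v.2, 0) :=
    fun φ hφ v hv ↦ by
    rw [(hs _ (hcA _)).tangentCoordDeriv_transition (hs φ hφ) (hc _) hv
      ((hs _ (hcA _)).tangentCoordDeriv_lineSpray (hc _)), haff.affine _ (hcA _) φ hφ _ ⟨hc _, hv⟩]
    simp
  -- the position, time and jet components of the spray, as equations in `T_v(TQ)`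
  have hcoord : ∀ v : TangentBundle 𝓘(ℝ, F) Q, _ := fun v ↦
    ((hA.isBundleChart _ (hcA v.proj)).tangentCoordDeriv_eq (hc _) _).symm.trans
      (hfield _ (hcA v.proj) v (hc _))
  let ξ : DynamicEquation (F := F) π :=
    { field := fun v ↦ lineSpray (c v.proj) v
      smooth := fun v hv ↦ by
        have hop := ((c v.proj).open_source.preimage
          (FiberBundle.continuous_proj F (TangentSpace 𝓘(ℝ, F)))).mem_nhds (hc v.proj)
        refine ContMDiffAt.contMDiffWithinAt (ContMDiffAt.congr_of_eventuallyEq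
          ((hs _ (hcA v.proj)).contMDiffOn_lineSpray.contMDiffAt hop) ?_)
        filter_upwards [hop] with w hw
        rw [(hs _ (hcA v.proj)).eq_lineSpray hw (hfield _ (hcA v.proj) w hw)]
      tangent := fun v hv ↦ (Prod.ext_iff.1 (Prod.ext_iff.1 (hcoord v)).2).1
      holonomic := fun v hv ↦ (hs _ (hcA v.proj)).chartDeriv_injective (hc _)
        (Prod.ext_iff.1 (hcoord v)).1 }
  exact ⟨ξ, A, hA, fun φ hφ v hv hvφ ↦
    ((hA.isBundleChart φ hφ).rhs_eq_zero_iff ξ hv hvφ).2 (hfield φ hφ v hvφ)⟩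

end DynamicEquationCoordinates

/-! ### Affine atlases of a bundle and of its typical fibre -/

section AffineMaps

variable {V₁ V₂ V₃ V₄ : Type*} [NormedAddCommGroup V₁] [NormedSpace ℝ V₁]
  [NormedAddCommGroup V₂] [NormedSpace ℝ V₂] [NormedAddCommGroup V₃] [NormedSpace ℝ V₃]
  [NormedAddCommGroup V₄] [NormedSpace ℝ V₄]

/-- Composing with affine maps and adding a linear one preserves the vanishing of the second
derivative. -/
theorem fderiv_fderiv_affine_comp_affine {τ : V₂ → V₃} {c : V₂} {j : V₁ →L[ℝ] V₂} {z : V₁}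
    (hτ : ContDiffAt ℝ ∞ τ (c + j z)) (h : fderiv ℝ (fderiv ℝ τ) (c + j z) = 0)
    (A : V₃ →L[ℝ] V₄) (L : V₁ →L[ℝ] V₄) :
    fderiv ℝ (fderiv ℝ fun z ↦ L z + A (τ (c + j z))) z = 0 := by
  have hj : ∀ z, HasFDerivAt (fun z ↦ c + j z) j z := fun z ↦ j.hasFDerivAt.const_add c
  have hev : ∀ᶠ z in 𝓝 z, HasFDerivAt (fun z ↦ L z + A (τ (c + j z)))
      (L + A.comp ((fderiv ℝ τ (c + j z)).comp j)) z := by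
    have h1 : ∀ᶠ u in 𝓝 (c + j z), DifferentiableAt ℝ τ u := by
      filter_upwards [(hτ.of_le (m := 1) (by norm_cast)).eventually (by simp)] with u hu
        using hu.differentiableAt (by simp)
    filter_upwards [(hj z).continuousAt.eventually h1] with z hz
    exact L.hasFDerivAt.add (A.hasFDerivAt.comp z (hz.hasFDerivAt.comp z (hj z)))
  have hev' : fderiv ℝ (fun z ↦ L z + A (τ (c + j z))) =ᶠ[𝓝 z]
      fun z ↦ L + A.comp ((fderiv ℝ τ (c + j z)).comp j) := by
    filter_upwards [hev] with z hz using hz.fderiv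
  have h2 : HasFDerivAt (fun z ↦ fderiv ℝ τ (c + j z)) (0 : V₁ →L[ℝ] V₂ →L[ℝ] V₃) z := by
    have h3 : HasFDerivAt (fderiv ℝ τ) (0 : V₂ →L[ℝ] V₂ →L[ℝ] V₃) (c + j z) := by
      rw [← h]
      exact ((hτ.fderiv_right (m := ∞) le_rfl).differentiableAt (by simp)).hasFDerivAt
    have h4 := h3.comp z (hj z)
    rw [ContinuousLinearMap.zero_comp] at h4
    exact h4
  have h4 := ((hasFDerivAt_const A z).clm_comp (h2.clm_comp (hasFDerivAt_const j z))).const_add L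
  rw [hev'.fderiv_eq, h4.fderiv]
  ext
  simp

end AffineMaps

section Charts

variable {W : Type*} [NormedAddCommGroup W] [NormedSpace ℝ W]
  {N : Type*} [TopologicalSpace N] [ChartedSpace W N]
  {V : Type*} [NormedAddCommGroup V] [NormedSpace ℝ V]

/-- Mutually inverse smooth maps between open sets form a smooth chart. -/
theorem exists_isSmoothChart {f : N → V} {g : V → N} {s : Set N} {t : Set V} (hs : IsOpen s)
    (ht : IsOpen t) (hst : MapsTo f s t) (hts : MapsTo g t s) (hgf : LeftInvOn g f s)
    (hfg : RightInvOn g f t) (hf : ContMDiffOn 𝓘(ℝ, W) 𝓘(ℝ, V) ∞ f s)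
    (hg : ContMDiffOn 𝓘(ℝ, V) 𝓘(ℝ, W) ∞ g t) :
    ∃ φ : OpenPartialHomeomorph N V, IsSmoothChart (W := W) φ ∧ φ.source = s ∧ φ.target = t ∧
      φ = f ∧ φ.symm = g :=
  ⟨{ toFun := f, invFun := g, source := s, target := t, map_source' := hst, map_target' := hts
     left_inv' := hgf, right_inv' := hfg, open_source := hs, open_target := ht
     continuousOn_toFun := hf.continuousOn, continuousOn_invFun := hg.continuousOn },
    ⟨hf, hg⟩, rfl, rfl, rfl, rfl⟩

end Charts

section Trivializations

variable {F : Type*} [NormedAddCommGroup F] [NormedSpace ℝ F]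
  {Q : Type*} [TopologicalSpace Q] [ChartedSpace F Q]
  {E : Type*} [NormedAddCommGroup E] [NormedSpace ℝ E]
  {M : Type*} [TopologicalSpace M] [ChartedSpace E M]
  {π : Q → ℝ}

/-- A smooth trivialization of `π : Q → ℝ` over the set `U` of instants: `x ↦ (π x, p x)` is a
diffeomorphism of `π⁻¹(U)` onto `U × M` with inverse `(t, m) ↦ q t m`. -/
structure IsSmoothTrivialization (π : Q → ℝ) (U : Set ℝ) (p : Q → M) (q : ℝ → M → Q) : Prop where
  smooth_fibre : ContMDiffOn 𝓘(ℝ, F) 𝓘(ℝ, E) ∞ p (π ⁻¹' U)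
  smooth_symm : ContMDiffOn (𝓘(ℝ, ℝ).prod 𝓘(ℝ, E)) 𝓘(ℝ, F) ∞
    (fun z : ℝ × M ↦ q z.1 z.2) (U ×ˢ univ)
  time_symm : ∀ t ∈ U, ∀ m, π (q t m) = t
  fibre_symm : ∀ t ∈ U, ∀ m, p (q t m) = m
  symm_fibre : ∀ x, π x ∈ U → q (π x) (p x) = x

theorem IsSmoothFibreBundle.contMDiff (h : IsSmoothFibreBundle (F := F) (E := E) M π) :
    ContMDiff 𝓘(ℝ, F) 𝓘(ℝ, ℝ) ∞ π := fun x ↦ by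
  obtain ⟨e, he, h1, -⟩ := h (π x)
  have hx : x ∈ e.source := e.mem_source.2 he
  have hs := e.open_source.mem_nhds hx
  refine ContMDiffAt.congr_of_eventuallyEq (contMDiffAt_fst.comp x (h1.contMDiffAt hs)) ?_
  filter_upwards [hs] with y hy using (e.coe_fst hy).symm

theorem IsSmoothFibreBundle.exists_isSmoothTrivialization
    (h : IsSmoothFibreBundle (F := F) (E := E) M π) (t : ℝ) :
    ∃ U, IsOpen U ∧ t ∈ U ∧ ∃ (p : Q → M) (q : ℝ → M → Q),
      IsSmoothTrivialization (F := F) (E := E) π U p q := by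
  obtain ⟨e, he, h1, h2⟩ := h t
  refine ⟨e.baseSet, e.open_baseSet, he, fun x ↦ (e x).2,
    fun t m ↦ e.toOpenPartialHomeomorph.symm (t, m), ?_, ?_, fun t ht m ↦ ?_, fun t ht m ↦ ?_,
    fun x hx ↦ ?_⟩
  · rw [← e.source_eq]
    exact contMDiff_snd.comp_contMDiffOn h1
  · rw [← e.target_eq]
    exact h2
  · exact e.proj_symm_apply' ht
  · rw [e.apply_symm_apply' ht]
  · have hx' := e.mem_source.2 hx
    rw [← e.coe_fst hx']
    exact e.left_inv hx'

theorem IsSmoothTrivialization.contMDiff_symm_apply {U : Set ℝ} {p : Q → M} {q : ℝ → M → Q}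
    (h : IsSmoothTrivialization (F := F) (E := E) π U p q) (hU : IsOpen U) {t : ℝ} (ht : t ∈ U) :
    ContMDiff 𝓘(ℝ, E) 𝓘(ℝ, F) ∞ (q t) := fun m ↦
  ContMDiffAt.comp (g := fun z : ℝ × M ↦ q z.1 z.2) m
    (h.smooth_symm.contMDiffAt ((hU.prod isOpen_univ).mem_nhds ⟨ht, mem_univ m⟩))
    (contMDiffAt_const.prodMk contMDiffAt_id)

/-- The fibre at an instant `t`, hence the typical fibre `M`, inherits an affine atlas from an affine
atlas of bundle coordinates. -/
theorem IsSmoothTrivialization.exists_isAffineAtlas {U : Set ℝ} {p : Q → M} {q : ℝ → M → Q}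
    (h : IsSmoothTrivialization (F := F) (E := E) π U p q) (hU : IsOpen U) {t : ℝ} (ht : t ∈ U)
    {A : Set (OpenPartialHomeomorph Q (ℝ × E))}
    (hA : ∀ φ ∈ A, IsBundleChart (F := F) π φ) (haff : IsAffineAtlas (W := F) A) :
    ∃ B : Set (OpenPartialHomeomorph M E), IsAffineAtlas (W := E) B := by
  have hq := h.contMDiff_symm_apply hU ht
  have hqt := h.time_symm t ht
  have hpq := h.fibre_symm t ht
  have hφq : ∀ φ ∈ A, ∀ m, q t m ∈ φ.source → φ (q t m) = (t, (φ (q t m)).2) :=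
    fun φ hφ m hm ↦ Prod.ext (((hA φ hφ).time _ hm).trans (hqt m)) rfl
  have hqp : ∀ φ ∈ A, ∀ y, (t, y) ∈ φ.target → π (φ.symm (t, y)) = t ∧
      q t (p (φ.symm (t, y))) = φ.symm (t, y) := fun φ hφ y hy ↦ by
    have h1 : π (φ.symm (t, y)) = t := by
      rw [← (hA φ hφ).time _ (φ.map_target hy), φ.right_inv hy]
    have h2 := h.symm_fibre (φ.symm (t, y)) (by rwa [h1])
    rw [h1] at h2
    exact ⟨h1, h2⟩
  refine ⟨{χ | IsSmoothChart (W := E) χ ∧ ∃ φ ∈ A, χ.source = q t ⁻¹' φ.source ∧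
    χ.target = Prod.mk t ⁻¹' φ.target ∧ (χ = fun m ↦ (φ (q t m)).2) ∧
    (χ.symm = fun y ↦ p (φ.symm (t, y)))}, fun χ hχ ↦ hχ.1, fun m ↦ ?_, ?_⟩
  · obtain ⟨φ, hφ, hm⟩ := haff.covers (q t m)
    obtain ⟨χ, h1, h2, h3, h4, h5⟩ := exists_isSmoothChart (W := E) (s := q t ⁻¹' φ.source)
      (t := Prod.mk t ⁻¹' φ.target) (f := fun m ↦ (φ (q t m)).2) (g := fun y ↦ p (φ.symm (t, y)))
      (φ.open_source.preimage hq.continuous) (φ.open_target.preimage (by fun_prop))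
      (fun m hm ↦ by
        rw [mem_preimage, ← hφq φ hφ m hm]
        exact φ.map_source hm)
      (fun y hy ↦ by
        rw [mem_preimage, (hqp φ hφ y hy).2]
        exact φ.map_target hy)
      (fun m hm ↦ by
        dsimp only
        rw [← hφq φ hφ m hm, φ.left_inv hm, hpq])
      (fun y hy ↦ by
        dsimp only
        rw [(hqp φ hφ y hy).2, φ.right_inv hy])
      (contDiff_snd.contMDiff.comp_contMDiffOn ((hA φ hφ).smooth.comp hq.contMDiffOn fun m hm ↦ hm))
      (h.smooth_fibre.comp ((hA φ hφ).smooth_symm.comp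
        (contDiff_prodMk_right t).contMDiff.contMDiffOn fun y hy ↦ hy) fun y hy ↦ by
          rw [mem_preimage, mem_preimage]
          rwa [(hqp φ hφ y hy).1])
    exact ⟨χ, ⟨h1, φ, hφ, h2, h3, h4, h5⟩, h2 ▸ hm⟩
  · rintro χ ⟨hχ, φ, hφ, hs, hT, hf, hg⟩ θ ⟨hθ, ψ, hψ, hs', -, hf', -⟩ m ⟨hm, hm'⟩
    have hmφ : q t m ∈ φ.source := by rwa [hs] at hm
    have hmψ : q t m ∈ ψ.source := by rwa [hs'] at hm'
    have hev : θ ∘ χ.symm =ᶠ[𝓝 (χ m)] fun y ↦ (0 : E →L[ℝ] E) y +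
        ContinuousLinearMap.snd ℝ ℝ E ((ψ ∘ φ.symm) ((t, 0) + ContinuousLinearMap.inr ℝ ℝ E y)) := by
      filter_upwards [χ.open_target.mem_nhds (χ.map_source hm)] with y hy
      rw [hT] at hy
      rw [hf', hg]
      simp [(hqp φ hφ y hy).2]
    have hpt : (t, 0) + ContinuousLinearMap.inr ℝ ℝ E (χ m) = φ (q t m) := by
      rw [hφq φ hφ m hmφ, hf]
      simp
    rw [hev.fderiv.fderiv_eq]
    refine fderiv_fderiv_affine_comp_affine ?_ ?_ _ _
    · rw [hpt]
      exact (hA φ hφ).isSmoothChart.contDiffAt_transition (hA ψ hψ).isSmoothChart hmφ hmψ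
    · rw [hpt]
      exact haff.affine φ hφ ψ hψ _ ⟨hmφ, hmψ⟩

/-- For a product `Q ≅ ℝ × M`, the charts `(t, f)` with `f` in an affine atlas of `M` form a
reference frame and an affine atlas of `Q`. -/
theorem IsSmoothTrivialization.exists_isReferenceFrame {p : Q → M} {q : ℝ → M → Q}
    (h : IsSmoothTrivialization (F := F) (E := E) π univ p q)
    (hπ : ContMDiff 𝓘(ℝ, F) 𝓘(ℝ, ℝ) ∞ π) {B : Set (OpenPartialHomeomorph M E)}
    (hB : IsAffineAtlas (W := E) B) :
    ∃ A : Set (OpenPartialHomeomorph Q (ℝ × E)), IsReferenceFrame (F := F) π A ∧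
      IsAffineAtlas (W := F) A := by
  have hp : ContMDiff 𝓘(ℝ, F) 𝓘(ℝ, E) ∞ p := contMDiffOn_univ.1 (by simpa using h.smooth_fibre)
  have hq : ContMDiff (𝓘(ℝ, ℝ).prod 𝓘(ℝ, E)) 𝓘(ℝ, F) ∞ (fun z : ℝ × M ↦ q z.1 z.2) :=
    contMDiffOn_univ.1 (by simpa using h.smooth_symm)
  have hqt : ∀ t m, π (q t m) = t := fun t ↦ h.time_symm t (mem_univ t)
  have hpq : ∀ t m, p (q t m) = m := fun t ↦ h.fibre_symm t (mem_univ t)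
  have hqp : ∀ x, q (π x) (p x) = x := fun x ↦ h.symm_fibre x (mem_univ _)
  set A : Set (OpenPartialHomeomorph Q (ℝ × E)) :=
    {χ | IsSmoothChart (W := F) χ ∧ ∃ φ ∈ B, χ.source = p ⁻¹' φ.source ∧
      χ.target = Prod.snd ⁻¹' φ.target ∧ (χ = fun x ↦ (π x, φ (p x))) ∧
      (χ.symm = fun z : ℝ × E ↦ q z.1 (φ.symm z.2))}
  have hcov : ∀ x, ∃ χ ∈ A, x ∈ χ.source := fun x ↦ by
    obtain ⟨φ, hφ, hx⟩ := hB.covers (p x)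
    have hφs := hB.isSmoothChart φ hφ
    obtain ⟨χ, h1, h2, h3, h4, h5⟩ := exists_isSmoothChart (W := F) (s := p ⁻¹' φ.source)
      (t := (Prod.snd ⁻¹' φ.target : Set (ℝ × E))) (f := fun x ↦ (π x, φ (p x)))
      (g := fun z : ℝ × E ↦ q z.1 (φ.symm z.2))
      (φ.open_source.preimage hp.continuous) (φ.open_target.preimage continuous_snd)
      (fun x hx ↦ φ.map_source hx)
      (fun z hz ↦ by
        rw [mem_preimage, hpq]
        exact φ.map_target hz)
      (fun x hx ↦ by
        dsimp only
        rw [φ.left_inv hx, hqp])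
      (fun z hz ↦ by
        dsimp only
        rw [hqt, hpq, φ.right_inv hz])
      (hπ.contMDiffOn.prodMk_space (hφs.smooth.comp hp.contMDiffOn fun x hx ↦ hx))
      (hq.comp_contMDiffOn (contDiff_fst.contMDiff.contMDiffOn.prodMk
        (hφs.smooth_symm.comp contDiff_snd.contMDiff.contMDiffOn fun z hz ↦ hz)))
    exact ⟨χ, ⟨h1, φ, hφ, h2, h3, h4, h5⟩, h2 ▸ hx⟩
  refine ⟨A, ⟨?_, hcov, ?_⟩, ⟨fun χ hχ ↦ hχ.1, hcov, ?_⟩⟩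
  · rintro χ ⟨hχ, φ, hφ, -, -, hf, -⟩
    exact ⟨hχ.smooth, hχ.smooth_symm, fun x _ ↦ by rw [hf]⟩
  · rintro χ ⟨-, φ, hφ, hs, -, hf, -⟩ θ ⟨-, ψ, hψ, -, -, hf', -⟩ x hx y hy hxy
    rw [hs] at hx hy
    rw [hf] at hxy
    have : p x = p y := φ.injOn hx.1 hy.1 hxy
    simp only [hf', this]
  · rintro χ ⟨hχ, φ, hφ, hs, hT, hf, hg⟩ θ ⟨hθ, ψ, hψ, hs', -, hf', -⟩ x ⟨hx, hx'⟩
    have hxφ : p x ∈ φ.source := by rwa [hs] at hx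
    have hxψ : p x ∈ ψ.source := by rwa [hs'] at hx'
    have hfun : θ ∘ χ.symm = fun z ↦ (ContinuousLinearMap.inl ℝ ℝ E).comp
          (ContinuousLinearMap.fst ℝ ℝ E) z + ContinuousLinearMap.inr ℝ ℝ E
          ((ψ ∘ φ.symm) (0 + ContinuousLinearMap.snd ℝ ℝ E z)) := by
      rw [hf', hg]
      funext z
      simp [hqt, hpq]
    have hpt : 0 + ContinuousLinearMap.snd ℝ ℝ E (χ x) = φ (p x) := by
      rw [hf]
      simp
    rw [hfun]
    refine fderiv_fderiv_affine_comp_affine ?_ ?_ _ _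
    · rw [hpt]
      exact (hB.isSmoothChart φ hφ).contDiffAt_transition (hB.isSmoothChart ψ hψ) hxφ hxψ
    · rw [hpt]
      exact hB.affine φ hφ ψ hψ _ ⟨hxφ, hxψ⟩

end Trivializations

/-! ### Triviality of fibre bundles over the time axis -/

section GlobalTrivialization

variable {F : Type*} [NormedAddCommGroup F] [NormedSpace ℝ F]
  {Q : Type*} [TopologicalSpace Q] [ChartedSpace F Q]
  {E : Type*} [NormedAddCommGroup E] [NormedSpace ℝ E]
  {M : Type*} [TopologicalSpace M] [ChartedSpace E M]
  {π : Q → ℝ} {U U₁ U₂ : Set ℝ} {p p₁ p₂ : Q → M} {q q₁ q₂ : ℝ → M → Q}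

/-- Being a smooth trivialization is local in time. -/
theorem isSmoothTrivialization_of_locally (hπ : Continuous π)
    (h : ∀ t ∈ U, ∃ U' p' q', IsOpen U' ∧ t ∈ U' ∧
      IsSmoothTrivialization (F := F) (E := E) π U' p' q' ∧
      (∀ x, π x ∈ U' → p x = p' x) ∧ ∀ s ∈ U', q s = q' s) :
    IsSmoothTrivialization (F := F) (E := E) π U p q where
  smooth_fibre x hx := by
    obtain ⟨U', p', q', hU', ht, h1, h2, h3⟩ := h (π x) hx
    have hn := (hU'.preimage hπ).mem_nhds ht
    refine ContMDiffAt.contMDiffWithinAt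
      (ContMDiffAt.congr_of_eventuallyEq (h1.smooth_fibre.contMDiffAt hn) ?_)
    filter_upwards [hn] with y hy using h2 y hy
  smooth_symm z hz := by
    obtain ⟨U', p', q', hU', ht, h1, h2, h3⟩ := h z.1 hz.1
    have hn := (hU'.prod isOpen_univ).mem_nhds (x := z) ⟨ht, mem_univ _⟩
    refine ContMDiffAt.contMDiffWithinAt
      (ContMDiffAt.congr_of_eventuallyEq (h1.smooth_symm.contMDiffAt hn) ?_)
    filter_upwards [hn] with y hy using by rw [h3 y.1 hy.1]
  time_symm t ht m := by
    obtain ⟨U', p', q', hU', ht, h1, h2, h3⟩ := h t ht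
    rw [h3 t ht, h1.time_symm t ht]
  fibre_symm t ht m := by
    obtain ⟨U', p', q', hU', ht, h1, h2, h3⟩ := h t ht
    rw [h3 t ht, h2 _ (by rwa [h1.time_symm t ht]), h1.fibre_symm t ht]
  symm_fibre x hx := by
    obtain ⟨U', p', q', hU', ht, h1, h2, h3⟩ := h (π x) hx
    rw [h3 _ ht, h2 x ht, h1.symm_fibre x ht]

namespace IsSmoothTrivialization

theorem mono (h : IsSmoothTrivialization (F := F) (E := E) π U₂ p q) (hU : U₁ ⊆ U₂) :
    IsSmoothTrivialization (F := F) (E := E) π U₁ p q where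
  smooth_fibre := h.smooth_fibre.mono (preimage_mono hU)
  smooth_symm := h.smooth_symm.mono (prod_mono_left hU)
  time_symm t ht := h.time_symm t (hU ht)
  fibre_symm t ht := h.fibre_symm t (hU ht)
  symm_fibre x hx := h.symm_fibre x (hU hx)

theorem neg (h : IsSmoothTrivialization (F := F) (E := E) π U p q) :
    IsSmoothTrivialization (F := F) (E := E) (fun x ↦ -π x) (Neg.neg ⁻¹' U) p
      (fun t ↦ q (-t)) where
  smooth_fibre x hx := by
    have hs : (fun x ↦ -π x) ⁻¹' (Neg.neg ⁻¹' U) = π ⁻¹' U := by ext; simp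
    rw [hs] at hx ⊢
    exact h.smooth_fibre x hx
  smooth_symm := h.smooth_symm.comp (f := fun z : ℝ × M ↦ (-z.1, z.2))
    ((contDiff_neg.contMDiff.comp contMDiff_fst).prodMk contMDiff_snd).contMDiffOn
    fun z hz ↦ ⟨hz.1, mem_univ _⟩
  time_symm t ht m := by rw [h.time_symm _ ht, neg_neg]
  fibre_symm t ht m := h.fibre_symm _ ht m
  symm_fibre x hx := by
    rw [neg_neg]
    exact h.symm_fibre x (by simpa using hx)

/-- The second trivialization corrected by the transition to the first one at the time `χ t`. Where
`χ t = t` the result is the first trivialization, but it is also defined at the times `t` of the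
second one beyond the reach of the first one, as long as both are defined at `χ t`. -/
theorem twist (h₁ : IsSmoothTrivialization (F := F) (E := E) π U₁ p₁ q₁)
    (h₂ : IsSmoothTrivialization (F := F) (E := E) π U₂ p₂ q₂)
    (hπ : ContMDiff 𝓘(ℝ, F) 𝓘(ℝ, ℝ) ∞ π) {χ : ℝ → ℝ} (hχ : ContDiff ℝ ∞ χ) :
    IsSmoothTrivialization (F := F) (E := E) π (U₂ ∩ χ ⁻¹' (U₁ ∩ U₂))
      (fun x ↦ p₁ (q₂ (χ (π x)) (p₂ x))) (fun t m ↦ q₂ t (p₂ (q₁ (χ t) m))) where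
  smooth_fibre := by
    have h1 : ContMDiffOn 𝓘(ℝ, F) (𝓘(ℝ, ℝ).prod 𝓘(ℝ, E)) ∞ (fun x ↦ (χ (π x), p₂ x))
        (π ⁻¹' (U₂ ∩ χ ⁻¹' (U₁ ∩ U₂))) :=
      (hχ.contMDiff.comp hπ).contMDiffOn.prodMk (h₂.smooth_fibre.mono fun x hx ↦ hx.1)
    refine h₁.smooth_fibre.comp (h₂.smooth_symm.comp h1 fun x hx ↦ ⟨hx.2.2, mem_univ _⟩)
      fun x hx ↦ ?_
    change π (q₂ (χ (π x)) (p₂ x)) ∈ U₁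
    rw [h₂.time_symm _ hx.2.2]
    exact hx.2.1
  smooth_symm := by
    have h1 : ContMDiffOn (𝓘(ℝ, ℝ).prod 𝓘(ℝ, E)) (𝓘(ℝ, ℝ).prod 𝓘(ℝ, E)) ∞
        (fun z : ℝ × M ↦ (χ z.1, z.2)) ((U₂ ∩ χ ⁻¹' (U₁ ∩ U₂)) ×ˢ univ) :=
      ((hχ.contMDiff.comp contMDiff_fst).prodMk contMDiff_snd).contMDiffOn
    have h2 := h₂.smooth_fibre.comp (h₁.smooth_symm.comp h1 fun z hz ↦ ⟨hz.1.2.1, mem_univ _⟩)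
      fun z hz ↦ by
        change π (q₁ (χ z.1) z.2) ∈ U₂
        rw [h₁.time_symm _ hz.1.2.1]
        exact hz.1.2.2
    exact h₂.smooth_symm.comp (contMDiffOn_fst.prodMk h2) fun z hz ↦ ⟨hz.1.1, mem_univ _⟩
  time_symm t ht m := h₂.time_symm t ht.1 _
  fibre_symm t ht m := by
    have h1 := h₁.time_symm _ ht.2.1 m
    have h2 := h₂.symm_fibre (q₁ (χ t) m) (by rw [h1]; exact ht.2.2)
    rw [h1] at h2
    rw [h₂.time_symm t ht.1, h₂.fibre_symm t ht.1, h2, h₁.fibre_symm _ ht.2.1]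
  symm_fibre x hx := by
    have h1 := h₂.time_symm _ hx.2.2 (p₂ x)
    have h2 := h₁.symm_fibre (q₂ (χ (π x)) (p₂ x)) (by rw [h1]; exact hx.2.1)
    rw [h1] at h2
    rw [h2, h₂.fibre_symm _ hx.2.2, h₂.symm_fibre x hx.1]

end IsSmoothTrivialization

/-- A smooth reparametrization of time which is the identity up to a time later than `T` and stays
close to `T` afterwards. -/
theorem exists_smooth_time_stop (T : ℝ) {ε : ℝ} (hε : 0 < ε) :
    ∃ χ : ℝ → ℝ, ContDiff ℝ ∞ χ ∧ ∃ δ > 0, (∀ t < T + δ, χ t = t) ∧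
      ∀ t, T < t → |χ t - T| < ε := by
  refine ⟨fun t ↦ T + (t - T) * (1 - Real.smoothTransition ((t - T) * (3 / ε) - 1)), ?_, ε / 3,
    by positivity, fun t ht ↦ ?_, fun t ht ↦ ?_⟩
  · have := Real.smoothTransition.contDiff (n := ⊤)
    fun_prop
  · have : Real.smoothTransition ((t - T) * (3 / ε) - 1) = 0 := by
      apply Real.smoothTransition.zero_of_nonpos
      have : (t - T) * (3 / ε) ≤ (ε / 3) * (3 / ε) := by gcongr; linarith
      have e : (ε / 3) * (3 / ε) = 1 := by field_simp
      linarith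
    simp [this]
  · have h0 := Real.smoothTransition.nonneg ((t - T) * (3 / ε) - 1)
    have h1 := Real.smoothTransition.le_one ((t - T) * (3 / ε) - 1)
    rw [add_sub_cancel_left, abs_of_nonneg (mul_nonneg (by linarith) (by linarith))]
    rcases lt_or_ge (t - T) ε with h | h
    · nlinarith
    · have : Real.smoothTransition ((t - T) * (3 / ε) - 1) = 1 := by
        apply Real.smoothTransition.one_of_one_le
        have : ε * (3 / ε) ≤ (t - T) * (3 / ε) := by gcongr
        have e : ε * (3 / ε) = 3 := by field_simp
        linarith
      simp [this, hε]

/-- Two trivializations near an instant `T` can be glued to one which agrees with the first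
one up to `T`. -/
theorem IsSmoothTrivialization.exists_glue
    (h₁ : IsSmoothTrivialization (F := F) (E := E) π U₁ p₁ q₁)
    (h₂ : IsSmoothTrivialization (F := F) (E := E) π U₂ p₂ q₂)
    (hπ : ContMDiff 𝓘(ℝ, F) 𝓘(ℝ, ℝ) ∞ π) (hU₁ : IsOpen U₁) (hU₂ : IsOpen U₂) {T : ℝ}
    (hT₁ : T ∈ U₁) (hT₂ : T ∈ U₂) :
    ∃ p q, IsSmoothTrivialization (F := F) (E := E) π (U₁ ∩ Iic T ∪ U₂ ∩ Ioi T) p q ∧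
      (∀ x, π x ≤ T → p x = p₁ x) ∧ ∀ t ≤ T, q t = q₁ t := by
  obtain ⟨ε, hε, hball⟩ := Metric.isOpen_iff.1 (hU₁.inter hU₂) T ⟨hT₁, hT₂⟩
  obtain ⟨χ, hχ, δ, hδ, hχ1, hχ2⟩ := exists_smooth_time_stop T hε
  have hχU : ∀ t, T < t → χ t ∈ U₁ ∩ U₂ := fun t ht ↦ hball (hχ2 t ht)
  have h₁₂ := h₁.twist h₂ hπ hχ
  refine ⟨fun x ↦ if π x ≤ T then p₁ x else p₁ (q₂ (χ (π x)) (p₂ x)),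
    fun t ↦ if t ≤ T then q₁ t else fun m ↦ q₂ t (p₂ (q₁ (χ t) m)),
    isSmoothTrivialization_of_locally hπ.continuous fun t ht ↦ ?_,
    fun x hx ↦ if_pos hx, fun t ht ↦ if_pos ht⟩
  by_cases htT : t ≤ T
  · refine ⟨U₁ ∩ Iio (T + δ) ∩ (Iio T ∪ U₂), p₁, q₁, ?_, ⟨⟨?_, lt_of_le_of_lt htT (by linarith)⟩, ?_⟩,
      h₁.mono fun s hs ↦ hs.1.1, fun x hx ↦ ?_, fun s hs ↦ ?_⟩
    · exact (hU₁.inter isOpen_Iio).inter (isOpen_Iio.union hU₂)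
    · rcases ht with ht | ht
      · exact ht.1
      · exact absurd htT (not_le.2 ht.2)
    · rcases htT.lt_or_eq with h | h
      · exact Or.inl h
      · exact Or.inr (h ▸ hT₂)
    · split_ifs with hxT
      · rfl
      · have hx2 : π x ∈ U₂ := hx.2.resolve_left fun h ↦ hxT (le_of_lt h)
        rw [hχ1 _ hx.1.2, h₂.symm_fibre x hx2]
    · split_ifs with hsT
      · rfl
      · have hs2 : s ∈ U₂ := hs.2.resolve_left fun h ↦ hsT (le_of_lt h)
        funext m
        have h1 := h₁.time_symm s hs.1.1 m
        have h2 := h₂.symm_fibre (q₁ s m) (by rwa [h1])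
        rw [h1] at h2
        rw [hχ1 _ hs.1.2, h2]
  · rw [not_le] at htT
    have ht2 : t ∈ U₂ := by
      rcases ht with ht | ht
      · exact absurd ht.2 (not_le.2 htT)
      · exact ht.1
    refine ⟨U₂ ∩ Ioi T, _, _, hU₂.inter isOpen_Ioi, ⟨ht2, htT⟩,
      h₁₂.mono fun s hs ↦ ⟨hs.1, hχU s hs.2⟩, fun x hx ↦ if_neg (not_le.2 hx.2),
      fun s hs ↦ if_neg (not_le.2 hs.2)⟩

/-- A trivialization up to the time `b` can be prolonged to any later time `b'` without changing it
up to a given time `T' < b`: the set of times up to which this is possible is unbounded, since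
gluing with a trivialization near its supremum would lead past the supremum. -/
theorem IsSmoothTrivialization.exists_extend_lt
    (hπ : ContMDiff 𝓘(ℝ, F) 𝓘(ℝ, ℝ) ∞ π)
    (hloc : ∀ t, ∃ V, IsOpen V ∧ t ∈ V ∧ ∃ (p : Q → M) (q : ℝ → M → Q),
      IsSmoothTrivialization (F := F) (E := E) π V p q) {T b : ℝ}
    (h : IsSmoothTrivialization (F := F) (E := E) π (U ∩ Iio b ∪ Ioo T b) p q)
    (hU : IsOpen U) {T' : ℝ} (hT : T ≤ T') (hT' : T' < b) (b' : ℝ) :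
    ∃ p' q', IsSmoothTrivialization (F := F) (E := E) π (U ∩ Iio b' ∪ Ioo T b') p' q' ∧
      (∀ x, π x ≤ T' → p' x = p x) ∧ ∀ t ≤ T', q' t = q t := by
  set S : Set ℝ := {s | ∃ p' q',
    IsSmoothTrivialization (F := F) (E := E) π (U ∩ Iio s ∪ Ioo T s) p' q' ∧
      (∀ x, π x ≤ T' → p' x = p x) ∧ ∀ t ≤ T', q' t = q t}
  have hbS : b ∈ S := ⟨p, q, h, fun _ _ ↦ rfl, fun _ _ ↦ rfl⟩
  have hunb : ¬ BddAbove S := fun hbdd ↦ by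
    obtain ⟨U₂, hU₂, hs₂, p₂, q₂, h₂⟩ := hloc (sSup S)
    obtain ⟨ε, hε, hball⟩ := Metric.isOpen_iff.1 hU₂ _ hs₂
    rw [Real.ball_eq_Ioo] at hball
    have hlt : max (sSup S - ε) T' < sSup S :=
      max_lt (by linarith) (hT'.trans_le (le_csSup hbdd hbS))
    obtain ⟨s, ⟨p₁, q₁, h₁, hp₁, hq₁⟩, hs⟩ := exists_lt_of_lt_csSup ⟨b, hbS⟩ hlt
    obtain ⟨T₁, hT₁, hT₁s⟩ := exists_between hs
    rw [max_lt_iff] at hT₁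
    have hss := le_csSup hbdd (show s ∈ S from ⟨p₁, q₁, h₁, hp₁, hq₁⟩)
    obtain ⟨p₃, q₃, h₃, hp₃, hq₃⟩ := h₁.exists_glue h₂ hπ
      ((hU.inter isOpen_Iio).union isOpen_Ioo) hU₂ (T := T₁)
      (Or.inr ⟨by linarith, hT₁s⟩) (hball ⟨hT₁.1, by linarith⟩)
    have : sSup S + ε ∈ S := by
      refine ⟨p₃, q₃, h₃.mono fun t ht ↦ ?_,
        fun x hx ↦ (hp₃ x (hx.trans hT₁.2.le)).trans (hp₁ x hx),
        fun t ht ↦ (hq₃ t (ht.trans hT₁.2.le)).trans (hq₁ t ht)⟩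
      have ht2 : t < sSup S + ε := by
        rcases ht with ht | ht
        exacts [ht.2, ht.2]
      rcases le_or_gt t T₁ with h1 | h1
      · refine Or.inl ⟨?_, h1⟩
        rcases ht with ht | ht
        · exact Or.inl ⟨ht.1, h1.trans_lt hT₁s⟩
        · exact Or.inr ⟨ht.1, h1.trans_lt hT₁s⟩
      · exact Or.inr ⟨hball ⟨hT₁.1.trans h1, ht2⟩, h1⟩
    have := le_csSup hbdd this
    linarith
  rw [not_bddAbove_iff] at hunb
  obtain ⟨s, ⟨p', q', h', hp', hq'⟩, hs⟩ := hunb b'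
  exact ⟨p', q', h'.mono (union_subset_union (inter_subset_inter_right _
    (Iio_subset_Iio hs.le)) (Ioo_subset_Ioo_right hs.le)), hp', hq'⟩

/-- A trivialization over `U` can be changed after `T ∈ U` and prolonged to all later times, as the
limit of prolongations which settle on longer and longer intervals. -/
theorem IsSmoothTrivialization.exists_extend_Ioi
    (hπ : ContMDiff 𝓘(ℝ, F) 𝓘(ℝ, ℝ) ∞ π)
    (hloc : ∀ t, ∃ V, IsOpen V ∧ t ∈ V ∧ ∃ (p : Q → M) (q : ℝ → M → Q),
      IsSmoothTrivialization (F := F) (E := E) π V p q)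
    (h : IsSmoothTrivialization (F := F) (E := E) π U p q) (hU : IsOpen U) {T : ℝ} (hT : T ∈ U) :
    ∃ (p' : Q → M) (q' : ℝ → M → Q),
      IsSmoothTrivialization (F := F) (E := E) π (U ∪ Ioi T) p' q' := by
  obtain ⟨b, hTb, hb⟩ := exists_Ico_subset_of_mem_nhds (hU.mem_nhds hT) (exists_gt T)
  have h0 : IsSmoothTrivialization (F := F) (E := E) π (U ∩ Iio (b + (0 : ℕ)) ∪
      Ioo T (b + (0 : ℕ))) p q := h.mono (by
    rw [Nat.cast_zero, add_zero]
    exact union_subset inter_subset_left (Ioo_subset_Ico_self.trans hb))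
  set c : ℝ := (T + b) / 2 with hc
  -- trivializations up to the time `b + n`, each agreeing with the previous one up to `c + n`
  let X : ℕ → Type _ := fun n ↦ {r : (Q → M) × (ℝ → M → Q) //
    IsSmoothTrivialization (F := F) (E := E) π (U ∩ Iio (b + n) ∪ Ioo T (b + n)) r.1 r.2}
  have hstep : ∀ n (r : X n), ∃ r' : X (n + 1), (∀ x, π x ≤ c + n → r'.1.1 x = r.1.1 x) ∧
      ∀ t ≤ c + n, r'.1.2 t = r.1.2 t := fun n r ↦ by
    have hn : (0 : ℝ) ≤ n := n.cast_nonneg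
    obtain ⟨p', q', h', hp', hq'⟩ := r.2.exists_extend_lt hπ hloc hU (T' := c + n)
      (by linarith) (by linarith) (b + (n + 1 : ℕ))
    exact ⟨⟨(p', q'), h'⟩, hp', hq'⟩
  choose next hp hq using hstep
  let f : ∀ n, X n := fun n ↦ Nat.rec ⟨(p, q), h0⟩ (fun n r ↦ next n r) n
  have hf : ∀ n k : ℕ, n ≤ k → (∀ x, π x ≤ c + n → (f k).1.1 x = (f n).1.1 x) ∧
      ∀ t ≤ c + n, (f k).1.2 t = (f n).1.2 t := fun n k hnk ↦ by
    induction k, hnk using Nat.le_induction with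
    | base => exact ⟨fun _ _ ↦ rfl, fun _ _ ↦ rfl⟩
    | succ k hnk ih =>
      have hnk' : (n : ℝ) ≤ k := by exact_mod_cast hnk
      exact ⟨fun x hx ↦ (hp k (f k) x (by linarith)).trans (ih.1 x hx),
        fun t ht ↦ (hq k (f k) t (by linarith)).trans (ih.2 t ht)⟩
  refine ⟨fun x ↦ (f ⌈π x - c⌉₊).1.1 x, fun t ↦ (f ⌈t - c⌉₊).1.2 t,
    isSmoothTrivialization_of_locally hπ.continuous fun t ht ↦ ?_⟩
  obtain ⟨n, hn⟩ := exists_nat_gt (t - c)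
  have key : ∀ s < c + n, ⌈s - c⌉₊ ≤ n ∧ s ≤ c + (⌈s - c⌉₊ : ℕ) := fun s hs ↦
    ⟨Nat.ceil_le.2 (by linarith), by linarith [Nat.le_ceil (s - c)]⟩
  refine ⟨(U ∪ Ioi T) ∩ Iio (c + n), (f n).1.1, (f n).1.2, (hU.union isOpen_Ioi).inter isOpen_Iio,
    ⟨ht, by simp only [mem_Iio]; linarith⟩, (f n).2.mono fun s hs ↦ ?_, fun x hx ↦ ?_,
    fun s hs ↦ ?_⟩
  · have hs2 : s < b + n := by
      have : s < c + n := hs.2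
      linarith
    rcases hs.1 with h1 | h1
    · exact Or.inl ⟨h1, hs2⟩
    · exact Or.inr ⟨h1, hs2⟩
  · exact ((hf _ _ (key _ hx.2).1).1 x (key _ hx.2).2).symm
  · exact ((hf _ _ (key _ hs.2).1).2 s (key _ hs.2).2).symm

/-- A smooth fibre bundle over the time axis is trivial. -/
theorem IsSmoothFibreBundle.exists_isSmoothTrivialization_univ
    (h : IsSmoothFibreBundle (F := F) (E := E) M π) :
    ∃ (p : Q → M) (q : ℝ → M → Q), IsSmoothTrivialization (F := F) (E := E) π univ p q := by
  obtain ⟨U, hU, h0, p, q, h₀⟩ := h.exists_isSmoothTrivialization 0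
  obtain ⟨p₁, q₁, h₁⟩ := h₀.exists_extend_Ioi h.contMDiff h.exists_isSmoothTrivialization hU h0
  -- the past is reached by reversing time
  have hloc : ∀ t, ∃ V, IsOpen V ∧ t ∈ V ∧ ∃ (p : Q → M) (q : ℝ → M → Q),
      IsSmoothTrivialization (F := F) (E := E) (fun x ↦ -π x) V p q := fun t ↦ by
    obtain ⟨V, hV, ht, p, q, h'⟩ := h.exists_isSmoothTrivialization (-t)
    exact ⟨_, hV.preimage continuous_neg, ht, _, _, h'.neg⟩
  obtain ⟨p₂, q₂, h₂⟩ := h₁.neg.exists_extend_Ioi (π := fun x ↦ -π x) (T := 0)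
    (contDiff_neg.contMDiff.comp h.contMDiff) hloc
    ((hU.union isOpen_Ioi).preimage continuous_neg) (by simp [h0])
  have h₃ := h₂.neg
  simp only [neg_neg] at h₃
  refine ⟨p₂, _, h₃.mono fun t _ ↦ ?_⟩
  rcases lt_trichotomy t 0 with ht | rfl | ht
  · exact Or.inr (by simpa using ht)
  · exact Or.inl (by simp [h0])
  · exact Or.inl (Or.inr (by simpa using ht))

end GlobalTrivialization

/-! ### Free motions and flat connections -/

theorem proposition1p10
    {E : Type*} [NormedAddCommGroup E] [NormedSpace ℝ E] [FiniteDimensional ℝ E]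
    {M : Type*} [TopologicalSpace M] [T2Space M] [SecondCountableTopology M]
    [ChartedSpace E M] [IsManifold 𝓘(ℝ, E) ∞ M]
    {F : Type*} [NormedAddCommGroup F] [NormedSpace ℝ F] [FiniteDimensional ℝ F]
    {Q : Type*} [TopologicalSpace Q] [T2Space Q] [SecondCountableTopology Q]
    [ChartedSpace F Q] [IsManifold 𝓘(ℝ, F) ∞ Q]
    (π : Q → ℝ) (hπ : IsSmoothFibreBundle (F := F) (E := E) M π) :
    (∃ ξ : DynamicEquation (F := F) π, ξ.IsFreeMotion E) ↔
      ∃ cov : CovariantDerivative 𝓘(ℝ, E) E (TangentSpace 𝓘(ℝ, E) : M → Type _),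
        IsFlatSymmetricConnection cov := by
  constructor
  · rintro ⟨ξ, A, hA, hξ⟩
    have haff : IsAffineAtlas (W := F) A :=
      ⟨fun φ hφ ↦ (hA.isBundleChart φ hφ).isSmoothChart, hA.covers, fun φ hφ ψ hψ x hx ↦
        ξ.fderiv_fderiv_transition_eq_zero (hA.isBundleChart φ hφ) (hA.isBundleChart ψ hψ)
          (hξ φ hφ) (hξ ψ hψ) hx.1 hx.2⟩
    obtain ⟨U, hU, h0, p, q, h⟩ := hπ.exists_isSmoothTrivialization 0
    obtain ⟨B, hB⟩ := h.exists_isAffineAtlas hU h0 hA.isBundleChart haff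
    exact hB.exists_isFlatSymmetricConnection
  · rintro ⟨cov, hcov⟩
    obtain ⟨B, hB⟩ := hcov.exists_isAffineAtlas
    obtain ⟨p, q, h⟩ := hπ.exists_isSmoothTrivialization_univ
    obtain ⟨A, hA, haff⟩ := h.exists_isReferenceFrame hπ.contMDiff hB
    exact exists_isFreeMotion_of_isAffineAtlas hA haff
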